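/- Let $N\in\mathbb N$. An $N$-graph $G$ is the quotient of the disjoint union of $N$ intervals $[0,1]\times\{i\}$, $i=1,\dots,N$, by an equivalence relation on the set of endpoints $\{0,1\}\times\{1,\dots,N\}$; its junctions are the classes of endpoints, and $\pi$ denotes the projection onto the quotient. A regular planar network $\mathcal N=(G,\Gamma)$ is a continuous map $\Gamma:G\to\mathbb R^2$ whose restriction to each edge is an immersion of class $H^2$. Let $\gamma^i:[0,\ell(\gamma^i)]\to\mathbb R^2$ be the arclength parametrization of the restriction of $\Gamma$ to the $i$-th edge, where $\ell(\gamma^i)$ is its length; let $\tau^i=\partial_s\gamma^i$, let $\nu^i$ be the counterclockwise rotation of $\tau^i$ by $\pi/2$, let $\vec k^i=\partial_s\tau^i=k^i\nu^i$, and write $\partial_s^\perp\varphi=\partial_s\varphi-\langle\partial_s\varphi,\tau^i\rangle\tau^i$ for vector fields $\varphi$ along $\gamma^i$. An endpoint $(z,i)$ corresponds to the arclength parameter $0$ if $z=0$ and $\ell(\gamma^i)$ if $z=1$. The elastic energy is $$\mathcal E(\mathcal N)=\sum_{i=1}^N\Big(\int_{\gamma^i}|\vec k^i|^2\,\mathrm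 ds+\ell(\gamma^i)\Big).$$ A regular variation of $\mathcal N$ is a family $\mathcal N_\varepsilon$ of networks with curves $\gamma^i_\varepsilon=\gamma^i+\varepsilon\psi^i$, where the fields $\psi^i:[0,\ell(\gamma^i)]\to\mathbb R^2$ are smooth and, at each junction, the values of $\psi^i$ at all the endpoints identified there coincide, and so do the values of $\langle\partial_s\psi^i,\nu^i\rangle$. The regular network $\mathcal N$ is a critical point of $\mathcal E$ if $\frac{d}{d\varepsilon}\mathcal E(\mathcal N_\varepsilon)|_{\varepsilon=0}=0$ for every regular variation. **Proposition.** Let $\mathcal N=(G,\Gamma)$ be a critical point of $\mathcal E$. Then, for every $i$, the arclength parametrization $\gamma^i$ is real analytic on $[0,\ell(\gamma^i)]$ and satisfies $$2(\partial_s^\perp)^2\vec k^i+|\vec k^i|^2\vec k^i-\vec k^i=0\qquad\text{on }(0,\ell(\gamma^i)),$$ or, equivalently, $$2\partial_s^2k^i+(k^i)^3-k^i=0\qquad\text{on }(0,\ell(\gamma^i)).$$ Moreover, at every junction $p$, $$\sum_{i:\,\pi(1,i)=p}k^i(\ell(\gamma^i))=\sum_{i:\,\pi(0,i)=p}k^i(0),$$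 $$\sum_{i:\,\pi(1,i)=p}\big[2\partial_s^\perp\vec k^i+(k^i)^2\tau^i-\tau^i\big](\ell(\gamma^i))=\sum_{i:\,\pi(0,i)=p}\big[2\partial_s^\perp\vec k^i+(k^i)^2\tau^i-\tau^i\big](0).$$ -/

import Mathlib

open Set MeasureTheory
open scoped ContDiff

noncomputable section

namespace ElasticNetwork

/-- The Euclidean plane. -/
abbrev Plane : Type := EuclideanSpace ℝ (Fin 2)

/-- Counterclockwise rotation by `π / 2`. -/
def rot (v : Plane) : Plane := !₂[-(v 1), v 0]

/-! ### Parametrized plane curves on `[0, L]` -/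

/-- The velocity of `γ : [0, L] → ℝ²` (one-sided at the endpoints); for a curve, or a field along
a curve, that is parametrized by arclength this is `∂ₛ`. -/
def dds (L : ℝ) (φ : ℝ → Plane) (x : ℝ) : Plane := derivWithin φ (Icc 0 L) x

/-- `γ` is of class `H²` on `[0, L]`: it is differentiable and its derivative is the primitive of
an `L²` function (the second derivative). -/
def IsH2 (L : ℝ) (γ : ℝ → Plane) : Prop :=
  DifferentiableOn ℝ γ (Icc 0 L) ∧
    ∃ g : ℝ → Plane, MemLp g 2 (volume.restrict (Icc 0 L)) ∧
      ∀ x ∈ Icc 0 L, dds L γ x = dds L γ 0 + ∫ y in (0 : ℝ)..x, g y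

/-- `γ` is an immersion of class `H²` of `[0, L]`. -/
def IsRegularCurve (L : ℝ) (γ : ℝ → Plane) : Prop :=
  IsH2 L γ ∧ ∀ x ∈ Icc 0 L, dds L γ x ≠ 0

/-- The unit tangent `τ`. -/
def tangent (L : ℝ) (γ : ℝ → Plane) (x : ℝ) : Plane := ‖dds L γ x‖⁻¹ • dds L γ x

/-- The unit normal `ν`, the counterclockwise rotation of `τ`. -/
def normal (L : ℝ) (γ : ℝ → Plane) (x : ℝ) : Plane := rot (tangent L γ x)

/-- The curvature vector `γ'' / |γ'|² - ⟨γ'', γ'⟩ γ' / |γ'|⁴` (for `H²` curves it is defined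
almost everywhere). -/
def curvatureVec (L : ℝ) (γ : ℝ → Plane) (x : ℝ) : Plane :=
  (‖dds L γ x‖ ^ 2)⁻¹ • dds L (dds L γ) x
    - (inner ℝ (dds L (dds L γ) x) (dds L γ x) / ‖dds L γ x‖ ^ 4) • dds L γ x

/-- The oriented curvature `k`, the normal component of the curvature vector. -/
def curvature (L : ℝ) (γ : ℝ → Plane) (x : ℝ) : ℝ :=
  inner ℝ (curvatureVec L γ x) (normal L γ x)

/-- The elastic energy `∫ |k|² ds + length` of a curve, with `ds = |γ'| dx`. -/
def elasticEnergy (L : ℝ) (γ : ℝ → Plane) : ℝ :=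
  (∫ x in (0 : ℝ)..L, ‖curvatureVec L γ x‖ ^ 2 * ‖dds L γ x‖) + ∫ x in (0 : ℝ)..L, ‖dds L γ x‖

/-- The arclength of `γ` on `[0, t]`, for a curve `γ` on `[0, 1]`. -/
def arclength (γ : ℝ → Plane) (t : ℝ) : ℝ := ∫ x in (0 : ℝ)..t, ‖dds 1 γ x‖

/-- The length of a curve `γ` on `[0, 1]`. -/
def curveLength (γ : ℝ → Plane) : ℝ := arclength γ 1

/-- The arclength parametrization of a regular curve `γ` on `[0, 1]`; it is meant on
`[0, curveLength γ]`, where it is `γ` composed with the inverse of the arclength function. -/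
def arcParam (γ : ℝ → Plane) (s : ℝ) : Plane :=
  γ (Function.invFunOn (arclength γ) (Icc 0 1) s)

/-- The operator `∂ₛ^⊥ φ = ∂ₛφ - ⟨∂ₛφ, ∂ₛγ⟩ ∂ₛγ` along a curve `γ` on `[0, L]` parametrized by
arclength. -/
def perpDeriv (L : ℝ) (γ φ : ℝ → Plane) (s : ℝ) : Plane :=
  dds L φ s - (inner ℝ (dds L φ s) (dds L γ s) : ℝ) • dds L γ s

/-! ### Graphs and networks -/

/-- The endpoints `(z, i)`, `z ∈ {0, 1}`, of the `N` intervals `[0, 1] × {i}`. -/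
abbrev Endpoint (N : ℕ) : Type := Fin 2 × Fin N

/-- The endpoint `(z, i)` as a point of the disjoint union of the intervals. -/
def endpointPoint {N : ℕ} (v : Endpoint N) : unitInterval × Fin N :=
  (if v.1 = 0 then 0 else 1, v.2)

/-- An `N`-graph is given by an equivalence relation on the endpoints of `N` intervals. -/
structure NGraph (N : ℕ) where
  sim : Setoid (Endpoint N)

/-- The graph as a topological space: the quotient of the disjoint union of the `N` intervals
that identifies equivalent endpoints. -/
def NGraph.Space {N : ℕ} (G : NGraph N) : Type :=
  Quot fun a b : unitInterval × Fin N =>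
    ∃ v w : Endpoint N, G.sim v w ∧ endpointPoint v = a ∧ endpointPoint w = b

instance {N : ℕ} (G : NGraph N) : TopologicalSpace G.Space :=
  inferInstanceAs (TopologicalSpace (Quot _))

/-- The projection of the disjoint union of the intervals onto the graph. -/
def NGraph.proj {N : ℕ} (G : NGraph N) (a : unitInterval × Fin N) : G.Space := Quot.mk _ a

/-- The vertices (junctions) of the graph. -/
def NGraph.Vertex {N : ℕ} (G : NGraph N) : Type := Quotient G.sim

/-- The vertex `π(z, i)` to which the endpoint `(z, i)` belongs. -/
def NGraph.vertex {N : ℕ} (G : NGraph N) (v : Endpoint N) : G.Vertex := Quotient.mk G.sim v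

open Classical in
/-- The indices `i` such that `(z, i) ∈ π⁻¹(p)`. -/
def NGraph.edgesAt {N : ℕ} (G : NGraph N) (p : G.Vertex) (z : Fin 2) : Finset (Fin N) :=
  Finset.univ.filter fun i => G.vertex (z, i) = p

/-- The restriction of `Γ` to the `i`-th edge, as a curve on `[0, 1]` (constantly extended
outside). -/
def edgeCurve {N : ℕ} {G : NGraph N} (Γ : C(G.Space, Plane)) (i : Fin N) (t : ℝ) : Plane :=
  Γ (G.proj (projIcc 0 1 zero_le_one t, i))

/-- A curve on `[0, 1]` is singular if it is constant. -/
def IsSingularCurve (γ : ℝ → Plane) : Prop := ∃ q : Plane, ∀ t ∈ Icc (0 : ℝ) 1, γ t = q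

/-- A planar network: a continuous map from an `N`-graph to the plane whose restriction to each
edge is constant or an immersion of class `H²`. -/
structure Network (N : ℕ) where
  graph : NGraph N
  map : C(graph.Space, Plane)
  curves : ∀ i, IsSingularCurve (edgeCurve map i) ∨ IsRegularCurve 1 (edgeCurve map i)

namespace Network

variable {N : ℕ} (𝒩 : Network N)

/-- A network is regular if none of its curves is singular. -/
def IsRegular : Prop := ∀ i, ¬ IsSingularCurve (edgeCurve 𝒩.map i)

/-- The length `ℓ(γⁱ)` of the `i`-th curve. -/
def len (i : Fin N) : ℝ := curveLength (edgeCurve 𝒩.map i)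

/-- The arclength parametrization `γⁱ : [0, ℓ(γⁱ)] → ℝ²` of the `i`-th curve. -/
def arc (i : Fin N) : ℝ → Plane := arcParam (edgeCurve 𝒩.map i)

/-- The arclength parameter, `0` or `ℓ(γⁱ)`, of the endpoint `(z, i)`. -/
def arcEnd (v : Endpoint N) : ℝ := if v.1 = 0 then 0 else 𝒩.len v.2

/-- Smooth fields `ψⁱ : [0, ℓ(γⁱ)] → ℝ²` that define a regular variation `γⁱ + ε ψⁱ`: at each
junction all the values `ψⁱ` agree, and so do all the normal components `⟨∂ₛψⁱ, νⁱ⟩`. -/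
structure IsRegularVariation (ψ : Fin N → ℝ → Plane) : Prop where
  smooth : ∀ i, ContDiffOn ℝ ∞ (ψ i) (Icc 0 (𝒩.len i))
  value_eq : ∀ v w : Endpoint N, 𝒩.graph.vertex v = 𝒩.graph.vertex w →
    ψ v.2 (𝒩.arcEnd v) = ψ w.2 (𝒩.arcEnd w)
  normal_eq : ∀ v w : Endpoint N, 𝒩.graph.vertex v = 𝒩.graph.vertex w →
    (inner ℝ (dds (𝒩.len v.2) (ψ v.2) (𝒩.arcEnd v))
        (normal (𝒩.len v.2) (𝒩.arc v.2) (𝒩.arcEnd v)) : ℝ)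
      = inner ℝ (dds (𝒩.len w.2) (ψ w.2) (𝒩.arcEnd w))
        (normal (𝒩.len w.2) (𝒩.arc w.2) (𝒩.arcEnd w))

/-- The energy of the varied network, which consists of the curves
`γⁱ + ε ψⁱ : [0, ℓ(γⁱ)] → ℝ²`. -/
def variationEnergy (ψ : Fin N → ℝ → Plane) (ε : ℝ) : ℝ :=
  ∑ i, elasticEnergy (𝒩.len i) fun s => 𝒩.arc i s + ε • ψ i s

/-- A critical point of the elastic energy: a regular network whose first variation along every
regular variation vanishes. -/
def IsCriticalPoint : Prop :=
  𝒩.IsRegular ∧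
    ∀ ψ : Fin N → ℝ → Plane, 𝒩.IsRegularVariation ψ → HasDerivAt (𝒩.variationEnergy ψ) 0 0

/-- The curvature vector of the `i`-th curve in the arclength parameter. -/
def kVec (i : Fin N) : ℝ → Plane := curvatureVec (𝒩.len i) (𝒩.arc i)

/-- The oriented curvature of the `i`-th curve in the arclength parameter. -/
def k (i : Fin N) : ℝ → ℝ := curvature (𝒩.len i) (𝒩.arc i)

/-- The vector `2 ∂ₛ^⊥ k⃗ + k² τ - τ` along the `i`-th curve. -/
def flux (i : Fin N) (s : ℝ) : Plane :=
  (2 : ℝ) • perpDeriv (𝒩.len i) (𝒩.arc i) (𝒩.kVec i) s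
    + 𝒩.k i s ^ 2 • tangent (𝒩.len i) (𝒩.arc i) s - tangent (𝒩.len i) (𝒩.arc i) s

end Network

end ElasticNetwork

end

/-! For a unit speed curve with tangent `τ` and curvature vector `a`, the first variation in the
direction `ψ` is the integral of `2⟨a, ψ''⟩ + (1 - 3|a|²)⟨τ, ψ'⟩`
(`UnitSpeedH2.hasDerivAt_elasticEnergy`). This makes sense for `a` merely in `L²`, and each edge is
such a curve in its arclength parameter (`IsRegularCurve.exists_unitSpeedH2`).

Fields supported on one edge, with zero values and first derivatives at its ends, are admissible
whatever the graph. The second order Du Bois-Reymond lemma then says that `2a` minus a primitive of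
`(1 - 3|a|²)τ` is affine. So `a` has a continuous representative, in fact a `C¹` one, with `2a' +
3|a|²τ - τ = F` for a constant vector `F` (`UnitSpeedH2.exists_isElastica`).

The rest is read off from this first order system. Since `a ⟂ τ`, one has `(|a|²)' = ⟨F, a⟩`; the
triple `(τ, a, |a|²)` solves a system whose only nonlinearity is one product, and induction with the
Leibniz rule gives Cauchy estimates, hence analyticity up to the endpoints. The tangential part `⟨F,
τ⟩ = |a|² - 1` shows that `F` is exactly the flux `2∂ₛ^⊥k + k²τ - τ`, so the flux is constant along
each edge, and differentiating gives both forms of the elastica equation.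

On solutions the first variation is the boundary term `2⟨a, ψ'⟩ - ⟨F, ψ⟩`
(`IsElastica.firstVariation_eq`). Hermite interpolation realizes any endpoint data compatible with
the junctions (`sum_boundary_eq`): zero values with derivative `ν` at the ends meeting in `p` give
the curvature balance, a common value `X` there with zero derivatives the flux balance. -/

/-! ### Analyticity from Cauchy estimates -/

open scoped Nat in
/-- Cauchy estimates for all iterated derivatives on a compact interval give analyticity. -/
theorem analyticOn_Icc_of_norm_iteratedDerivWithin_le {E : Type*} [NormedAddCommGroup E]
    [NormedSpace ℝ E] [CompleteSpace E] {f : ℝ → E} {a b A K : ℝ} (hab : a < b)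
    (hf : ContDiffOn ℝ ∞ f (Icc a b)) (hK : 0 < K)
    (h : ∀ n : ℕ, ∀ x ∈ Icc a b, ‖iteratedDerivWithin n f (Icc a b) x‖ ≤ A * K ^ n * n !) :
    AnalyticOn ℝ f (Icc a b) := by
  intro x₀ hx₀
  have hA : 0 ≤ A := by simpa using (norm_nonneg _).trans (h 0 x₀ hx₀)
  let p : FormalMultilinearSeries ℝ ℝ E := fun n =>
    ContinuousMultilinearMap.mkPiRing ℝ (Fin n)
      ((n ! : ℝ)⁻¹ • iteratedDerivWithin n f (Icc a b) x₀)
  have hp (n : ℕ) : ‖p n‖ ≤ A * K ^ n := by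
    have hn : (0 : ℝ) < n ! := by positivity
    simp only [p, ContinuousMultilinearMap.norm_mkPiRing, norm_smul, norm_inv, Real.norm_natCast]
    rw [inv_mul_le_iff₀ hn]
    linarith [h n x₀ hx₀]
  -- With this radius `K|y| < 1/2`, so the Taylor remainder, of order `n (K|y|)^n`, tends to zero.
  let r : NNReal := ⟨(2 * K)⁻¹, by positivity⟩
  have hr : (r : ℝ) = (2 * K)⁻¹ := rfl
  have hr0 : 0 < r := by
    rw [← NNReal.coe_pos, hr]; positivity
  refine ⟨p, r, ?_, by exact_mod_cast hr0, ?_⟩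
  · refine p.le_radius_of_bound A fun n => ?_
    calc ‖p n‖ * (r : ℝ) ^ n ≤ A * K ^ n * (r : ℝ) ^ n := by gcongr; exact hp n
      _ = A * (1 / 2) ^ n := by
        rw [mul_assoc, ← mul_pow, hr]; congr 2; field_simp
      _ ≤ A * 1 := by gcongr; exact pow_le_one₀ (by norm_num) (by norm_num)
      _ = A := mul_one A
  · intro y hy hyr
    rw [insert_eq_of_mem hx₀] at hy
    have hyr' : K * |y| < 1 / 2 := by
      rw [Metric.eball_coe, mem_ball_zero_iff, Real.norm_eq_abs, hr] at hyr
      calc K * |y| < K * (2 * K)⁻¹ := by gcongr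
        _ = 1 / 2 := by field_simp
    have hq0 : 0 ≤ K * |y| := by positivity
    have hterm (n : ℕ) : p n (fun _ => y)
        = ((n ! : ℝ)⁻¹ * y ^ n) • iteratedDerivWithin n f (Icc a b) x₀ := by
      simp [p, smul_smul, mul_comm]
    have hsum : Summable fun n => p n fun _ => y := by
      refine Summable.of_norm_bounded
        (summable_geometric_of_lt_one hq0 (by linarith) |>.mul_left A) fun n => ?_
      calc ‖p n fun _ => y‖ ≤ ‖p n‖ * ‖y‖ ^ n := by
            simpa using (p n).le_opNorm fun _ => y
        _ ≤ A * K ^ n * ‖y‖ ^ n := by gcongr; exact hp n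
        _ = A * (K * |y|) ^ n := by rw [mul_pow, Real.norm_eq_abs]; ring
    -- The shift by one makes the partial sum with `n + 1` terms the Taylor polynomial of degree
    -- `n`.
    rw [hsum.hasSum_iff_tendsto_nat, ← Filter.tendsto_add_atTop_iff_nat 1,
      tendsto_iff_norm_sub_tendsto_zero]
    have hlim : Filter.Tendsto (fun n : ℕ => A * K * |y| * (n * (K * |y|) ^ n + (K * |y|) ^ n))
        Filter.atTop (nhds 0) := by
      have h1 := tendsto_self_mul_const_pow_of_lt_one hq0 (by linarith : K * |y| < 1)
      have h2 := tendsto_pow_atTop_nhds_zero_of_lt_one hq0 (by linarith : K * |y| < 1)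
      simpa using (h1.add h2).const_mul (A * K * |y|)
    refine squeeze_zero (fun _ => norm_nonneg _) (fun n => ?_) hlim
    have hseg : uIcc x₀ (x₀ + y) ⊆ Icc a b := (convex_Icc a b).ordConnected.uIcc_subset hx₀ hy
    -- The evaluation point is fixed and the centre `t` of the Taylor polynomial moves: its
    -- derivative telescopes to a single term, and the mean value inequality between `t = x₀` and `t
    -- = x₀ + y` bounds the remainder. This works for vector values and at endpoints of the
    -- interval.
    have hder : ∀ t ∈ uIcc x₀ (x₀ + y), HasDerivWithinAt
        (fun z => taylorWithinEval f n (Icc a b) z (x₀ + y))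
        (((n ! : ℝ)⁻¹ * (x₀ + y - t) ^ n) • iteratedDerivWithin (n + 1) f (Icc a b) t)
        (uIcc x₀ (x₀ + y)) t := fun t ht =>
      (hasDerivWithinAt_taylorWithinEval_at_Icc (x₀ + y) hab (hseg ht)
        (hf.of_le (by exact_mod_cast le_top))
        (hf.differentiableOn_iteratedDerivWithin (by exact_mod_cast ENat.natCast_lt_top n)
          (uniqueDiffOn_Icc hab))).mono hseg
    have hbd : ∀ t ∈ uIcc x₀ (x₀ + y),
        ‖((n ! : ℝ)⁻¹ * (x₀ + y - t) ^ n) • iteratedDerivWithin (n + 1) f (Icc a b) t‖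
          ≤ A * K * (n + 1) * (K * |y|) ^ n := by
      intro t ht
      have hn : (0 : ℝ) < n ! := by positivity
      have h1 : |x₀ + y - t| ≤ |y| := by
        have := abs_sub_right_of_mem_uIcc ht
        simpa using this
      rw [norm_smul, norm_mul, norm_inv, Real.norm_natCast, norm_pow, Real.norm_eq_abs]
      calc (n ! : ℝ)⁻¹ * |x₀ + y - t| ^ n * ‖iteratedDerivWithin (n + 1) f (Icc a b) t‖
          ≤ (n ! : ℝ)⁻¹ * |y| ^ n * (A * K ^ (n + 1) * (n + 1)!) := by
            gcongr
            exact h (n + 1) t (hseg ht)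
        _ = A * K * (n + 1) * (K * |y|) ^ n := by
            rw [Nat.factorial_succ, mul_pow, pow_succ]; push_cast; field_simp
    have := (convex_uIcc x₀ (x₀ + y)).norm_image_sub_le_of_norm_hasDerivWithin_le hder hbd
      right_mem_uIcc left_mem_uIcc
    rw [taylorWithinEval_self, taylor_within_apply] at this
    simp only [hterm]
    refine le_trans (le_of_eq ?_) (this.trans (le_of_eq ?_))
    · simp
    · simp; ring

/-! ### The integrated elastica equation: smoothness and analyticity -/

namespace ElasticNetwork

/-- `c` is a unit speed curve on `[0, L]` with tangent `τ` and curvature vector `a` that satisfies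
the once integrated elastica equation `2 a' + 3 |a|² τ - τ = F`. -/
structure IsElastica (L : ℝ) (c τ a : ℝ → Plane) (F : Plane) : Prop where
  pos : 0 < L
  curve_deriv : ∀ s ∈ Icc 0 L, HasDerivWithinAt c (τ s) (Icc 0 L) s
  tangent_deriv : ∀ s ∈ Icc 0 L, HasDerivWithinAt τ (a s) (Icc 0 L) s
  curvature_deriv : ∀ s ∈ Icc 0 L, HasDerivWithinAt a
    ((1 / 2 : ℝ) • F + (1 / 2 : ℝ) • τ s + (-3 / 2 : ℝ) • (inner ℝ (a s) (a s) : ℝ) • τ s)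
    (Icc 0 L) s
  unit : ∀ s ∈ Icc 0 L, ‖τ s‖ = 1

namespace IsElastica

variable {L : ℝ} {c τ a : ℝ → Plane} {F : Plane}

theorem uniqueDiffOn (h : IsElastica L c τ a F) : UniqueDiffOn ℝ (Icc 0 L) :=
  uniqueDiffOn_Icc h.pos

theorem inner_tangent_self (h : IsElastica L c τ a F) {s : ℝ} (hs : s ∈ Icc 0 L) :
    (inner ℝ (τ s) (τ s) : ℝ) = 1 := by
  rw [real_inner_self_eq_norm_sq, h.unit s hs, one_pow]

theorem inner_tangent_curvature (h : IsElastica L c τ a F) {s : ℝ} (hs : s ∈ Icc 0 L) :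
    (inner ℝ (τ s) (a s) : ℝ) = 0 := by
  have h1 := (h.tangent_deriv s hs).inner ℝ (h.tangent_deriv s hs)
  have h2 : HasDerivWithinAt (fun t => (inner ℝ (τ t) (τ t) : ℝ)) 0 (Icc 0 L) s :=
    (hasDerivWithinAt_const s (Icc 0 L) (1 : ℝ)).congr (fun t ht => h.inner_tangent_self ht)
      (h.inner_tangent_self hs)
  have h3 := (h.uniqueDiffOn s hs).eq_deriv _ h1 h2
  rw [real_inner_comm (τ s) (a s)] at h3
  linarith

/-- Since `a ⟂ τ`, only the `F` term of `a'` contributes. The derivative of `|a|²` is thus linear in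
`a`, so `|a|²` can be treated as a third unknown and the cubic term becomes one product. -/
theorem hasDerivWithinAt_inner_curvature_self (h : IsElastica L c τ a F) {s : ℝ}
    (hs : s ∈ Icc 0 L) :
    HasDerivWithinAt (fun t => (inner ℝ (a t) (a t) : ℝ)) (inner ℝ F (a s)) (Icc 0 L) s := by
  convert! (h.curvature_deriv s hs).inner ℝ (h.curvature_deriv s hs) using 1
  have h0 := h.inner_tangent_curvature hs
  rw [real_inner_comm (a s) (τ s)] at h0
  simp only [inner_add_left, inner_add_right, real_inner_smul_left, real_inner_smul_right,
    real_inner_comm (a s) (τ s), h0, real_inner_comm (a s) F]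
  ring

theorem contDiffOn_nat (h : IsElastica L c τ a F) (n : ℕ) :
    ContDiffOn ℝ n τ (Icc 0 L) ∧ ContDiffOn ℝ n a (Icc 0 L) := by
  induction n with
  | zero =>
    exact ⟨contDiffOn_zero.2 fun s hs => (h.tangent_deriv s hs).continuousWithinAt,
      contDiffOn_zero.2 fun s hs => (h.curvature_deriv s hs).continuousWithinAt⟩
  | succ n ih =>
    obtain ⟨h1, h2⟩ := ih
    push_cast
    constructor
    · refine (contDiffOn_succ_iff_derivWithin h.uniqueDiffOn).2
        ⟨fun s hs => (h.tangent_deriv s hs).differentiableWithinAt, by simp, ?_⟩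
      exact h2.congr fun s hs => (h.tangent_deriv s hs).derivWithin (h.uniqueDiffOn s hs)
    · refine (contDiffOn_succ_iff_derivWithin h.uniqueDiffOn).2
        ⟨fun s hs => (h.curvature_deriv s hs).differentiableWithinAt, by simp, ?_⟩
      refine ContDiffOn.congr ?_ fun s hs =>
        (h.curvature_deriv s hs).derivWithin (h.uniqueDiffOn s hs)
      exact (contDiffOn_const.add (h1.const_smul _)).add
        (((h2.inner ℝ h2).smul h1).const_smul _)

theorem contDiffOn_tangent (h : IsElastica L c τ a F) : ContDiffOn ℝ ∞ τ (Icc 0 L) :=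
  contDiffOn_infty.2 fun n => (h.contDiffOn_nat n).1

theorem contDiffOn_curvature (h : IsElastica L c τ a F) : ContDiffOn ℝ ∞ a (Icc 0 L) :=
  contDiffOn_infty.2 fun n => (h.contDiffOn_nat n).2

theorem contDiffOn_curve (h : IsElastica L c τ a F) : ContDiffOn ℝ ∞ c (Icc 0 L) :=
  (contDiffOn_infty_iff_derivWithin h.uniqueDiffOn).2
    ⟨fun s hs => (h.curve_deriv s hs).differentiableWithinAt,
      h.contDiffOn_tangent.congr fun s hs =>
        (h.curve_deriv s hs).derivWithin (h.uniqueDiffOn s hs)⟩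

theorem iteratedDerivWithin_succ_curve (h : IsElastica L c τ a F) (n : ℕ) {s : ℝ}
    (hs : s ∈ Icc 0 L) :
    iteratedDerivWithin (n + 1) c (Icc 0 L) s = iteratedDerivWithin n τ (Icc 0 L) s := by
  rw [iteratedDerivWithin_succ']
  exact iteratedDerivWithin_congr
    (fun t ht => (h.curve_deriv t ht).derivWithin (h.uniqueDiffOn t ht)) hs

theorem iteratedDerivWithin_succ_tangent (h : IsElastica L c τ a F) (n : ℕ) {s : ℝ}
    (hs : s ∈ Icc 0 L) :
    iteratedDerivWithin (n + 1) τ (Icc 0 L) s = iteratedDerivWithin n a (Icc 0 L) s := by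
  rw [iteratedDerivWithin_succ']
  exact iteratedDerivWithin_congr
    (fun t ht => (h.tangent_deriv t ht).derivWithin (h.uniqueDiffOn t ht)) hs

theorem norm_iteratedDerivWithin_succ_inner_curvature_le (h : IsElastica L c τ a F) (n : ℕ)
    {s : ℝ} (hs : s ∈ Icc 0 L) :
    ‖iteratedDerivWithin (n + 1) (fun t => (inner ℝ (a t) (a t) : ℝ)) (Icc 0 L) s‖
      ≤ ‖F‖ * ‖iteratedDerivWithin n a (Icc 0 L) s‖ := by
  rw [iteratedDerivWithin_succ', iteratedDerivWithin_congr (g := innerSL ℝ F ∘ a)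
    (fun t ht => (h.hasDerivWithinAt_inner_curvature_self ht).derivWithin (h.uniqueDiffOn t ht))
    hs, ← norm_iteratedFDerivWithin_eq_norm_iteratedDerivWithin,
    ← norm_iteratedFDerivWithin_eq_norm_iteratedDerivWithin]
  have := (innerSL ℝ F).norm_iteratedFDerivWithin_comp_left (h.contDiffOn_curvature s hs)
    h.uniqueDiffOn hs (n := n) (by exact_mod_cast le_top)
  rwa [innerSL_apply_norm] at this

theorem norm_iteratedDerivWithin_succ_curvature_le (h : IsElastica L c τ a F) (n : ℕ)
    {s : ℝ} (hs : s ∈ Icc 0 L) :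
    ‖iteratedDerivWithin (n + 1) a (Icc 0 L) s‖
      ≤ ‖F‖ + ‖iteratedDerivWithin n τ (Icc 0 L) s‖ + 3 / 2 *
        ∑ i ∈ Finset.range (n + 1), (n.choose i : ℝ)
          * ‖iteratedDerivWithin i (fun t => (inner ℝ (a t) (a t) : ℝ)) (Icc 0 L) s‖
          * ‖iteratedDerivWithin (n - i) τ (Icc 0 L) s‖ := by
  have hτ := h.contDiffOn_tangent
  have hm := h.contDiffOn_curvature.inner ℝ h.contDiffOn_curvature
  have hn : ((n : ℕ∞) : WithTop ℕ∞) ≤ ∞ := by exact_mod_cast le_top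
  have h1 : ContDiffOn ℝ n (fun _ : ℝ => (1 / 2 : ℝ) • F) (Icc 0 L) := contDiffOn_const
  have h2 : ContDiffOn ℝ n (fun t => (1 / 2 : ℝ) • τ t) (Icc 0 L) := (hτ.of_le hn).const_smul _
  have h3 : ContDiffOn ℝ n (fun t => (inner ℝ (a t) (a t) : ℝ) • τ t) (Icc 0 L) :=
    (hm.smul hτ).of_le hn
  rw [iteratedDerivWithin_succ', iteratedDerivWithin_congr
    (fun t ht => (h.curvature_deriv t ht).derivWithin (h.uniqueDiffOn t ht)) hs,
    iteratedDerivWithin_fun_add hs h.uniqueDiffOn ((h1.add h2) s hs) ((h3.const_smul _) s hs),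
    iteratedDerivWithin_fun_add hs h.uniqueDiffOn (h1 s hs) (h2 s hs),
    iteratedDerivWithin_fun_const_smul hs h.uniqueDiffOn _ (h3 s hs),
    iteratedDerivWithin_fun_const_smul hs h.uniqueDiffOn _ ((hτ.of_le hn) s hs)]
  refine (norm_add₃_le).trans ?_
  gcongr
  · rw [iteratedDerivWithin_const]
    split_ifs
    · rw [norm_smul]; norm_num; linarith [norm_nonneg F]
    · simp
  · rw [norm_smul]; norm_num; linarith [norm_nonneg (iteratedDerivWithin n τ (Icc 0 L) s)]
  · rw [norm_smul]
    have := norm_iteratedFDerivWithin_smul_le hm hτ h.uniqueDiffOn hs hn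
    simp only [norm_iteratedFDerivWithin_eq_norm_iteratedDerivWithin] at this
    rw [show ‖(-3 / 2 : ℝ)‖ = 3 / 2 by norm_num]
    gcongr

-- The three bounds are proved together by strong induction. The Leibniz sum has `n + 1` terms; the
-- binomial coefficients cancel the factorials, and the factor `n + 1` is absorbed in passing from
-- `n!` to `(n + 1)!`.
open scoped Nat in
theorem exists_norm_iteratedDerivWithin_le (h : IsElastica L c τ a F) :
    ∃ A K : ℝ, 0 < K ∧ ∀ (n : ℕ), ∀ s ∈ Icc 0 L,
      ‖iteratedDerivWithin n τ (Icc 0 L) s‖ ≤ A * K ^ n * n ! ∧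
      ‖iteratedDerivWithin n a (Icc 0 L) s‖ ≤ A * K ^ n * n ! ∧
      ‖iteratedDerivWithin n (fun t => (inner ℝ (a t) (a t) : ℝ)) (Icc 0 L) s‖
        ≤ A * K ^ n * n ! := by
  obtain ⟨B, hB⟩ := isCompact_Icc.exists_bound_of_continuousOn h.contDiffOn_curvature.continuousOn
  have hB0 : 0 ≤ B := (norm_nonneg _).trans (hB 0 ⟨le_rfl, h.pos.le⟩)
  -- `A` dominates `|τ| = 1`, `|a| ≤ B` and `|a|² ≤ B²`, the case `n = 0`.
  set A : ℝ := 1 + B + B ^ 2 with hA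
  have hA1 : 1 ≤ A := by nlinarith
  have hF := norm_nonneg F
  -- The summands pay for the constant `F`, the linear term and the product term of the equation for
  -- `a'`.
  set K : ℝ := ‖F‖ + 1 + 3 * A with hK
  have hK1 : 1 ≤ K := by nlinarith
  refine ⟨A, K, by positivity, fun n => ?_⟩
  induction n using Nat.strong_induction_on with
  | _ n ih =>
  intro s hs
  rcases n with _ | n
  · simp only [iteratedDerivWithin_zero, pow_zero, Nat.factorial_zero, Nat.cast_one, mul_one,
      h.unit s hs, real_inner_self_eq_norm_sq, norm_pow, norm_norm]
    have := hB s hs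
    refine ⟨hA1, by nlinarith, ?_⟩
    have : ‖a s‖ ^ 2 ≤ B ^ 2 := by gcongr
    nlinarith
  · obtain ⟨ihτ, iha, -⟩ := ih n n.lt_succ_self s hs
    have hKn : (1 : ℝ) ≤ K ^ n := one_le_pow₀ hK1
    have hfac : (1 : ℝ) ≤ n ! := by exact_mod_cast n.factorial_pos
    have hfac' : ((n + 1)! : ℝ) = (n + 1) * n ! := by rw [Nat.factorial_succ]; push_cast; ring
    have hn0 : (0 : ℝ) ≤ n := n.cast_nonneg
    set X : ℝ := A * K ^ n * n ! with hX
    have hX1 : 1 ≤ X := by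
      rw [hX]
      calc (1 : ℝ) = 1 * 1 * 1 := by ring
        _ ≤ _ := by gcongr
    have hgoal : A * K ^ (n + 1) * (n + 1)! = K * ((n + 1) * X) := by
      rw [hfac', hX]; ring
    have hXn : X ≤ (n + 1) * X := by nlinarith
    rw [hgoal]
    refine ⟨?_, ?_, ?_⟩
    · rw [h.iteratedDerivWithin_succ_tangent n hs]
      nlinarith
    · refine (h.norm_iteratedDerivWithin_succ_curvature_le n hs).trans ?_
      have hsum : ∑ i ∈ Finset.range (n + 1), (n.choose i : ℝ)
          * ‖iteratedDerivWithin i (fun t => (inner ℝ (a t) (a t) : ℝ)) (Icc 0 L) s‖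
          * ‖iteratedDerivWithin (n - i) τ (Icc 0 L) s‖ ≤ (n + 1) * (A * X) := by
        calc _ ≤ ∑ i ∈ Finset.range (n + 1), A * X := by
              refine Finset.sum_le_sum fun i hi => ?_
              have hi' : i ≤ n := Nat.lt_succ_iff.1 (Finset.mem_range.1 hi)
              calc _ ≤ (n.choose i : ℝ) * (A * K ^ i * i !) * (A * K ^ (n - i) * (n - i)!) := by
                    gcongr
                    · exact (ih i (by omega) s hs).2.2
                    · exact (ih (n - i) (by omega) s hs).1
                _ = A * (A * (K ^ i * K ^ (n - i)) * (n.choose i * i ! * (n - i)!)) := by ring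
                _ = A * X := by
                    rw [← pow_add, Nat.add_sub_cancel' hi', hX]
                    congr 2
                    exact_mod_cast Nat.choose_mul_factorial_mul_factorial hi'
          _ = (n + 1) * (A * X) := by simp
      calc _ ≤ ‖F‖ * ((n + 1) * X) + (n + 1) * X + 3 / 2 * ((n + 1) * (A * X)) := by
            gcongr
            · nlinarith
            · linarith
        _ ≤ K * ((n + 1) * X) := by
            have : 0 ≤ A * ((n + 1) * X) := by positivity
            rw [hK]; nlinarith
    · refine (h.norm_iteratedDerivWithin_succ_inner_curvature_le n hs).trans ?_
      calc ‖F‖ * ‖iteratedDerivWithin n a (Icc 0 L) s‖ ≤ K * ((n + 1) * X) := by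
            gcongr
            · rw [hK]; linarith
            · linarith

theorem analyticOn (h : IsElastica L c τ a F) : AnalyticOn ℝ c (Icc 0 L) := by
  obtain ⟨A, K, hK, hAK⟩ := h.exists_norm_iteratedDerivWithin_le
  obtain ⟨B, hB⟩ := isCompact_Icc.exists_bound_of_continuousOn h.contDiffOn_curve.continuousOn
  have h0 : (0 : ℝ) ∈ Icc 0 L := ⟨le_rfl, h.pos.le⟩
  have hA : 0 ≤ A := by simpa using (norm_nonneg _).trans (hAK 0 0 h0).1
  have hB0 : 0 ≤ B := (norm_nonneg _).trans (hB 0 h0)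
  -- The derivatives of `c` are those of `τ` shifted by one; `B` covers order zero, and `K + 1 ≥ 1`
  -- allows one more power.
  refine analyticOn_Icc_of_norm_iteratedDerivWithin_le (A := A + B) (K := K + 1) h.pos
    h.contDiffOn_curve (by positivity) fun n s hs => ?_
  rcases n with _ | n
  · simpa using (hB s hs).trans (by linarith)
  · rw [h.iteratedDerivWithin_succ_curve n hs]
    calc _ ≤ A * K ^ n * n.factorial := (hAK n s hs).1
      _ ≤ (A + B) * (K + 1) ^ n * (n + 1).factorial := by
        gcongr <;> linarith
      _ ≤ (A + B) * (K + 1) ^ (n + 1) * (n + 1).factorial := by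
        gcongr
        · linarith
        · exact Nat.le_succ n

end IsElastica
end ElasticNetwork

/-! ### Plane geometry and the curvature of solutions -/

namespace ElasticNetwork

theorem inner_plane (u v : Plane) : (inner ℝ u v : ℝ) = u 0 * v 0 + u 1 * v 1 := by
  rw [PiLp.inner_apply, Fin.sum_univ_two]
  simp [mul_comm]

@[simp] theorem rot_zero_coord (v : Plane) : rot v 0 = -(v 1) := rfl

@[simp] theorem rot_one_coord (v : Plane) : rot v 1 = v 0 := rfl

theorem plane_ext {u v : Plane} (h0 : u 0 = v 0) (h1 : u 1 = v 1) : u = v := by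
  ext i; fin_cases i <;> assumption

theorem rot_rot (v : Plane) : rot (rot v) = -v := plane_ext (by simp) (by simp)

theorem inner_rot_self (v : Plane) : (inner ℝ v (rot v) : ℝ) = 0 := by
  rw [inner_plane]; simp; ring

theorem inner_rot_rot (u v : Plane) : (inner ℝ (rot u) (rot v) : ℝ) = inner ℝ u v := by
  rw [inner_plane, inner_plane]; simp; ring

/-- Rotation by `π / 2` as a continuous linear map. -/
noncomputable def rotL : Plane →L[ℝ] Plane :=
  LinearMap.toContinuousLinearMap
    { toFun := rot
      map_add' := fun u v => plane_ext (by simp; ring) (by simp)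
      map_smul' := fun r v => plane_ext (by simp) (by simp) }

theorem rotL_apply (v : Plane) : rotL v = rot v := rfl

/-- A vector orthogonal to a unit vector is a multiple of its rotation. -/
theorem eq_inner_rot_smul_rot {t v : Plane} (ht : (inner ℝ t t : ℝ) = 1)
    (htv : (inner ℝ t v : ℝ) = 0) : v = (inner ℝ v (rot t) : ℝ) • rot t := by
  rw [inner_plane] at ht htv ⊢
  refine plane_ext ?_ ?_
  · simp only [PiLp.smul_apply, smul_eq_mul, rot_zero_coord, rot_one_coord]
    linear_combination v 0 * (-ht) + t 0 * htv
  · simp only [PiLp.smul_apply, smul_eq_mul, rot_zero_coord, rot_one_coord]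
    linear_combination v 1 * (-ht) + t 1 * htv

theorem dds_congr {L : ℝ} {φ χ : ℝ → Plane} (h : EqOn φ χ (Icc 0 L)) {s : ℝ}
    (hs : s ∈ Icc 0 L) : dds L φ s = dds L χ s :=
  derivWithin_congr h (h hs)

namespace IsElastica

variable {L : ℝ} {c τ a : ℝ → Plane} {F : Plane}

theorem dds_curve (h : IsElastica L c τ a F) {s : ℝ} (hs : s ∈ Icc 0 L) : dds L c s = τ s :=
  (h.curve_deriv s hs).derivWithin (h.uniqueDiffOn s hs)

theorem dds_dds_curve (h : IsElastica L c τ a F) {s : ℝ} (hs : s ∈ Icc 0 L) :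
    dds L (dds L c) s = a s := by
  rw [dds_congr (fun t ht => h.dds_curve ht) hs]
  exact (h.tangent_deriv s hs).derivWithin (h.uniqueDiffOn s hs)

theorem tangent_eq (h : IsElastica L c τ a F) {s : ℝ} (hs : s ∈ Icc 0 L) :
    tangent L c s = τ s := by
  rw [tangent, h.dds_curve hs, h.unit s hs, inv_one, one_smul]

theorem normal_eq (h : IsElastica L c τ a F) {s : ℝ} (hs : s ∈ Icc 0 L) :
    normal L c s = rot (τ s) := by
  rw [normal, h.tangent_eq hs]

theorem inner_curvature_tangent (h : IsElastica L c τ a F) {s : ℝ} (hs : s ∈ Icc 0 L) :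
    (inner ℝ (a s) (τ s) : ℝ) = 0 := by
  rw [real_inner_comm, h.inner_tangent_curvature hs]

theorem curvatureVec_eq (h : IsElastica L c τ a F) {s : ℝ} (hs : s ∈ Icc 0 L) :
    curvatureVec L c s = a s := by
  rw [curvatureVec, h.dds_curve hs, h.dds_dds_curve hs, h.inner_curvature_tangent hs,
    h.unit s hs]
  simp

theorem curvature_eq (h : IsElastica L c τ a F) {s : ℝ} (hs : s ∈ Icc 0 L) :
    curvature L c s = inner ℝ (a s) (rot (τ s)) := by
  rw [curvature, h.curvatureVec_eq hs, h.normal_eq hs]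

theorem curvature_smul_normal (h : IsElastica L c τ a F) {s : ℝ} (hs : s ∈ Icc 0 L) :
    a s = curvature L c s • rot (τ s) := by
  rw [h.curvature_eq hs]
  exact eq_inner_rot_smul_rot (h.inner_tangent_self hs) (h.inner_tangent_curvature hs)

theorem curvature_sq (h : IsElastica L c τ a F) {s : ℝ} (hs : s ∈ Icc 0 L) :
    curvature L c s ^ 2 = inner ℝ (a s) (a s) := by
  rw [h.curvature_smul_normal hs, real_inner_smul_left, real_inner_smul_right, inner_rot_rot,
    h.inner_tangent_self hs]
  ring

/-- The tangential component of the integrated equation. -/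
theorem inner_flux_tangent (h : IsElastica L c τ a F) {s : ℝ} (hs : s ∈ Icc 0 L) :
    (inner ℝ F (τ s) : ℝ) = inner ℝ (a s) (a s) - 1 := by
  have h1 := (h.curvature_deriv s hs).inner ℝ (h.tangent_deriv s hs)
  have h2 : HasDerivWithinAt (fun t => (inner ℝ (a t) (τ t) : ℝ)) 0 (Icc 0 L) s :=
    (hasDerivWithinAt_const s (Icc 0 L) (0 : ℝ)).congr
      (fun t ht => h.inner_curvature_tangent ht) (h.inner_curvature_tangent hs)
  have h3 := (h.uniqueDiffOn s hs).eq_deriv _ h1 h2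
  simp only [inner_add_left, real_inner_smul_left, h.inner_tangent_self hs] at h3
  linarith

/-- By `inner_flux_tangent`, the tangential part of `a'` is `-|a|² τ`; removing it changes the
coefficient of `|a|² τ` from `-3/2` to `-1/2`, which is what identifies the flux with `F`. -/
theorem perpDeriv_curvatureVec (h : IsElastica L c τ a F) {s : ℝ} (hs : s ∈ Icc 0 L) :
    perpDeriv L c (curvatureVec L c) s
      = (1 / 2 : ℝ) • F + (1 / 2 : ℝ) • τ s - (1 / 2 : ℝ) • (inner ℝ (a s) (a s) : ℝ) • τ s := by
  have hd : dds L (curvatureVec L c) s = (1 / 2 : ℝ) • F + (1 / 2 : ℝ) • τ s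
      + (-3 / 2 : ℝ) • (inner ℝ (a s) (a s) : ℝ) • τ s := by
    rw [dds_congr (fun t ht => h.curvatureVec_eq ht) hs]
    exact (h.curvature_deriv s hs).derivWithin (h.uniqueDiffOn s hs)
  rw [perpDeriv, hd, h.dds_curve hs]
  simp only [inner_add_left, real_inner_smul_left, h.inner_tangent_self hs,
    h.inner_flux_tangent hs]
  module

theorem perpDeriv_perpDeriv_curvatureVec (h : IsElastica L c τ a F) {s : ℝ} (hs : s ∈ Icc 0 L) :
    perpDeriv L c (perpDeriv L c (curvatureVec L c)) s
      = (1 / 2 : ℝ) • a s - (1 / 2 : ℝ) • (inner ℝ (a s) (a s) : ℝ) • a s := by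
  have hd : dds L (perpDeriv L c (curvatureVec L c)) s = (1 / 2 : ℝ) • a s
      - (1 / 2 : ℝ) • ((inner ℝ (a s) (a s) : ℝ) • a s + (inner ℝ F (a s) : ℝ) • τ s) := by
    rw [dds_congr (fun t ht => h.perpDeriv_curvatureVec ht) hs]
    refine HasDerivWithinAt.derivWithin ?_ (h.uniqueDiffOn s hs)
    have h1 := (h.tangent_deriv s hs).const_smul (1 / 2 : ℝ)
    have h2 := (h.hasDerivWithinAt_inner_curvature_self hs).fun_smul (h.tangent_deriv s hs)
    exact (h1.const_add ((1 / 2 : ℝ) • F)).sub (h2.const_smul (1 / 2 : ℝ))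
  rw [perpDeriv, hd, h.dds_curve hs]
  simp only [inner_add_left, inner_sub_left, real_inner_smul_left, h.inner_tangent_self hs,
    h.inner_curvature_tangent hs]
  module

theorem elastica_equation (h : IsElastica L c τ a F) {s : ℝ} (hs : s ∈ Icc 0 L) :
    (2 : ℝ) • perpDeriv L c (perpDeriv L c (curvatureVec L c)) s
      + ‖curvatureVec L c s‖ ^ 2 • curvatureVec L c s - curvatureVec L c s = 0 := by
  rw [h.perpDeriv_perpDeriv_curvatureVec hs, h.curvatureVec_eq hs, ← real_inner_self_eq_norm_sq]
  module

theorem flux_eq (h : IsElastica L c τ a F) {s : ℝ} (hs : s ∈ Icc 0 L) :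
    (2 : ℝ) • perpDeriv L c (curvatureVec L c) s + curvature L c s ^ 2 • tangent L c s
      - tangent L c s = F := by
  rw [h.perpDeriv_curvatureVec hs, h.curvature_sq hs, h.tangent_eq hs]
  module

theorem derivWithin_curvature (h : IsElastica L c τ a F) {s : ℝ} (hs : s ∈ Icc 0 L) :
    derivWithin (curvature L c) (Icc 0 L) s = (1 / 2) * inner ℝ F (rot (τ s)) := by
  rw [derivWithin_congr (fun t ht => h.curvature_eq ht) (h.curvature_eq hs)]
  refine HasDerivWithinAt.derivWithin ?_ (h.uniqueDiffOn s hs)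
  have h1 := rotL.hasFDerivAt.comp_hasDerivWithinAt s (h.tangent_deriv s hs)
  convert! (h.curvature_deriv s hs).inner ℝ h1 using 1
  simp only [Function.comp_apply, rotL_apply, inner_add_left, real_inner_smul_left,
    inner_rot_self]
  ring

/-- From `k' = ⟨F, ν⟩ / 2` and `ν' = -kτ` one gets `2k'' = -k⟨F, τ⟩ = -k(k² - 1)`. -/
theorem iteratedDerivWithin_two_curvature (h : IsElastica L c τ a F) {s : ℝ}
    (hs : s ∈ Icc 0 L) :
    2 * iteratedDerivWithin 2 (curvature L c) (Icc 0 L) s + curvature L c s ^ 3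
      - curvature L c s = 0 := by
  have h1 := rotL.hasFDerivAt.comp_hasDerivWithinAt s (h.tangent_deriv s hs)
  have h2 : HasDerivWithinAt (fun t => (1 / 2) * (inner ℝ F (rot (τ t)) : ℝ))
      ((1 / 2) * inner ℝ F (rot (a s))) (Icc 0 L) s := by
    convert! ((hasDerivWithinAt_const s (Icc 0 L) F).inner ℝ h1).const_mul (1 / 2) using 1
    simp [rotL_apply]
  rw [iteratedDerivWithin_succ, iteratedDerivWithin_one, derivWithin_congr
    (fun t ht => h.derivWithin_curvature ht) (h.derivWithin_curvature hs),
    h2.derivWithin (h.uniqueDiffOn s hs)]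
  have h3 : rot (a s) = -(curvature L c s) • τ s := by
    conv_lhs => rw [h.curvature_smul_normal hs, ← rotL_apply, map_smul, rotL_apply, rot_rot]
    simp
  rw [h3, real_inner_smul_right, h.inner_flux_tangent hs, ← h.curvature_sq hs]
  ring

end IsElastica
end ElasticNetwork

/-! ### Pointwise variation of the energy density -/

namespace ElasticNetwork

/-- `|k|² ds` in terms of velocity `v` and acceleration `w`. -/
noncomputable def bendingDensity (v w : Plane) : ℝ := (inner ℝ w (rot v) : ℝ) ^ 2 / ‖v‖ ^ 5

/-- The derivative of `bendingDensity` at `(v, w)` in the direction `(v', w')`. -/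
noncomputable def bendingDensityDeriv (v w v' w' : Plane) : ℝ :=
  2 * inner ℝ w (rot v) * (inner ℝ w' (rot v) + inner ℝ w (rot v')) / ‖v‖ ^ 5
    - 5 * inner ℝ w (rot v) ^ 2 * inner ℝ v v' / ‖v‖ ^ 7

theorem norm_rot (v : Plane) : ‖rot v‖ = ‖v‖ := by
  rw [← sq_eq_sq₀ (norm_nonneg _) (norm_nonneg _), ← real_inner_self_eq_norm_sq,
    ← real_inner_self_eq_norm_sq, inner_rot_rot]

/-- In the plane `|w|²|v|² - ⟨w, v⟩² = ⟨w, rot v⟩²`. For `v = 0` both sides vanish by the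
conventions on division by zero. -/
theorem norm_curvatureVec_sq_mul (v w : Plane) :
    ‖(‖v‖ ^ 2)⁻¹ • w - (inner ℝ w v / ‖v‖ ^ 4) • v‖ ^ 2 * ‖v‖ = bendingDensity v w := by
  rcases eq_or_ne v 0 with rfl | hv
  · simp [bendingDensity]
  have hn : ‖v‖ ≠ 0 := norm_ne_zero_iff.2 hv
  have h2 : ‖v‖ ^ 2 = v 0 ^ 2 + v 1 ^ 2 := by
    rw [← real_inner_self_eq_norm_sq, inner_plane]; ring
  have h : ‖(‖v‖ ^ 2)⁻¹ • w - (inner ℝ w v / ‖v‖ ^ 4) • v‖ ^ 2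
      = inner ℝ w (rot v) ^ 2 / ‖v‖ ^ 6 := by
    rw [← real_inner_self_eq_norm_sq]
    simp only [inner_sub_left, inner_sub_right, real_inner_smul_left, real_inner_smul_right,
      real_inner_self_eq_norm_sq v, real_inner_comm w v]
    field_simp
    simp only [inner_plane, rot_zero_coord, rot_one_coord, h2]
    ring
  rw [h, bendingDensity]
  field_simp

theorem hasDerivAt_norm_affine {v v' : Plane} {ε : ℝ} (h : v + ε • v' ≠ 0) :
    HasDerivAt (fun t : ℝ => ‖v + t • v'‖) (inner ℝ (v + ε • v') v' / ‖v + ε • v'‖) ε := by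
  have h1 : HasDerivAt (fun t : ℝ => v + t • v') v' ε := by
    simpa using ((hasDerivAt_id ε).smul_const v').const_add v
  have hn : ‖v + ε • v'‖ ≠ 0 := norm_ne_zero_iff.2 h
  have h2 := h1.norm_sq.sqrt (pow_ne_zero 2 hn)
  simp only [Real.sqrt_sq (norm_nonneg _)] at h2
  convert! h2 using 1
  field_simp

theorem hasDerivAt_bendingDensity_affine {v v' w w' : Plane} {ε : ℝ} (h : v + ε • v' ≠ 0) :
    HasDerivAt (fun t : ℝ => bendingDensity (v + t • v') (w + t • w'))
      (bendingDensityDeriv (v + ε • v') (w + ε • w') v' w') ε := by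
  have h1 : HasDerivAt (fun t : ℝ => v + t • v') v' ε := by
    simpa using ((hasDerivAt_id ε).smul_const v').const_add v
  have h2 : HasDerivAt (fun t : ℝ => w + t • w') w' ε := by
    simpa using ((hasDerivAt_id ε).smul_const w').const_add w
  have hn : ‖v + ε • v'‖ ≠ 0 := norm_ne_zero_iff.2 h
  have h3 := ((h2.inner ℝ (rotL.hasFDerivAt.comp_hasDerivAt ε h1)).pow 2).div
    ((hasDerivAt_norm_affine h).pow 5) (pow_ne_zero 5 hn)
  convert! h3 using 1
  simp only [bendingDensityDeriv, Function.comp_apply, rotL_apply, Pi.pow_apply]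
  field_simp
  push_cast
  ring

theorem abs_inner_rot_le (v w : Plane) : |(inner ℝ w (rot v) : ℝ)| ≤ ‖w‖ * ‖v‖ := by
  simpa [norm_rot] using abs_real_inner_le_norm w (rot v)

/-- Uniformly in the curve parameter, small variations of a unit speed curve remain immersed, so
negative powers of the speed stay bounded. The `M + 1` keeps the threshold meaningful when `M = 0`.
-/
theorem norm_affine_bounds {v v' : Plane} {M ε : ℝ} (hv : ‖v‖ = 1) (hM : ‖v'‖ ≤ M)
    (hε : |ε| ≤ 1 / (2 * (M + 1))) : 1 / 2 ≤ ‖v + ε • v'‖ ∧ ‖v + ε • v'‖ ≤ 2 := by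
  have hM0 : 0 ≤ M := (norm_nonneg _).trans hM
  have h1 : ‖ε • v'‖ ≤ 1 / 2 := by
    rw [norm_smul, Real.norm_eq_abs]
    calc |ε| * ‖v'‖ ≤ 1 / (2 * (M + 1)) * (M + 1) := by gcongr; linarith
      _ = 1 / 2 := by field_simp
  constructor
  · have := norm_sub_norm_le v (-(ε • v'))
    rw [norm_neg, sub_neg_eq_add] at this
    linarith
  · have := norm_add_le v (ε • v')
    linarith

/-- A majorant independent of `ε` for dominated differentiation. Only its quadratic growth in `w`
matters, since the acceleration is just in `L²`; the constant is crude. -/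
theorem abs_bendingDensityDeriv_affine_le {v v' w w' : Plane} {M ε : ℝ} (hv : ‖v‖ = 1)
    (hv' : ‖v'‖ ≤ M) (hw' : ‖w'‖ ≤ M) (hε : |ε| ≤ 1 / (2 * (M + 1))) :
    |bendingDensityDeriv (v + ε • v') (w + ε • w') v' w'| ≤ 6000 * M * (‖w‖ + 3) ^ 2 := by
  have hM0 : 0 ≤ M := (norm_nonneg _).trans hv'
  obtain ⟨hn1, hn2⟩ := norm_affine_bounds hv hv' hε
  have hw : ‖w + ε • w'‖ ≤ ‖w‖ + 3 := by
    refine (norm_add_le _ _).trans ?_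
    gcongr
    rw [norm_smul, Real.norm_eq_abs]
    calc |ε| * ‖w'‖ ≤ 1 / (2 * (M + 1)) * (M + 1) := by gcongr; linarith
      _ = 1 / 2 := by field_simp
      _ ≤ 3 := by norm_num
  set V := v + ε • v'
  set W := w + ε • w'
  set X := ‖w‖ + 3
  have hX : 3 ≤ X := by simp [X]
  have hD : |(inner ℝ W (rot V) : ℝ)| ≤ X * 2 :=
    (abs_inner_rot_le _ _).trans (by gcongr)
  have hD1 : |(inner ℝ w' (rot V) : ℝ)| ≤ M * 2 := (abs_inner_rot_le _ _).trans (by gcongr)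
  have hD2 : |(inner ℝ W (rot v') : ℝ)| ≤ X * M := (abs_inner_rot_le _ _).trans (by gcongr)
  have hI : |(inner ℝ V v' : ℝ)| ≤ 2 * M := (abs_real_inner_le_norm _ _).trans (by gcongr)
  have h5 : (1 / 2 : ℝ) ^ 5 ≤ ‖V‖ ^ 5 := by gcongr
  have h7 : (1 / 2 : ℝ) ^ 7 ≤ ‖V‖ ^ 7 := by gcongr
  have hp5 : 0 < ‖V‖ ^ 5 := by positivity
  have hp7 : 0 < ‖V‖ ^ 7 := by positivity
  rw [bendingDensityDeriv]
  refine (abs_sub _ _).trans ?_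
  have e1 : |2 * (inner ℝ W (rot V) : ℝ) * (inner ℝ w' (rot V) + inner ℝ W (rot v')) / ‖V‖ ^ 5|
      ≤ 2 * (X * 2) * (M * 2 + X * M) / (1 / 2) ^ 5 := by
    rw [abs_div, abs_mul, abs_mul, abs_two, abs_of_pos hp5]
    gcongr
    exact (abs_add_le _ _).trans (by gcongr)
  have e2 : |5 * (inner ℝ W (rot V) : ℝ) ^ 2 * inner ℝ V v' / ‖V‖ ^ 7|
      ≤ 5 * (X * 2) ^ 2 * (2 * M) / (1 / 2) ^ 7 := by
    rw [abs_div, abs_mul, abs_mul, abs_of_pos hp7, abs_pow, abs_of_pos (by norm_num : (0:ℝ) < 5)]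
    gcongr
  refine (add_le_add e1 e2).trans ?_
  have h3 : 0 ≤ M * X * (X - 3) := mul_nonneg (by positivity) (sub_nonneg.2 hX)
  have h1 : 0 ≤ M * X := by positivity
  -- The two estimates add up to `5248 M X² + 256 M X`; `X ≥ 3` absorbs the linear term.
  calc _ = 6000 * M * X ^ 2 - (752 * (M * X * (X - 3)) + 2000 * (M * X)) := by ring
    _ ≤ _ := by linarith

end ElasticNetwork

/-! ### First variation of unit speed `H²` curves -/

namespace ElasticNetwork

/-- `c` is a unit speed curve on `[0, L]` whose tangent `τ` is a primitive of `a ∈ L²`. -/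
structure UnitSpeedH2 (L : ℝ) (c τ a : ℝ → Plane) : Prop where
  pos : 0 < L
  curve_deriv : ∀ s ∈ Icc 0 L, HasDerivWithinAt c (τ s) (Icc 0 L) s
  unit : ∀ s ∈ Icc 0 L, ‖τ s‖ = 1
  memLp : MemLp a 2 (volume.restrict (Icc 0 L))
  tangent_eq : ∀ s ∈ Icc 0 L, τ s = τ 0 + ∫ y in (0 : ℝ)..s, a y

theorem intervalIntegrable_of_integrableOn_Icc {E : Type*} [NormedAddCommGroup E] {f : ℝ → E}
    {L : ℝ} (hL : 0 ≤ L) (hf : IntegrableOn f (Icc 0 L)) : IntervalIntegrable f volume 0 L :=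
  (intervalIntegrable_iff_integrableOn_Icc_of_le hL).2 hf

namespace UnitSpeedH2

variable {L : ℝ} {c τ a : ℝ → Plane}

theorem integrableOn (h : UnitSpeedH2 L c τ a) : IntegrableOn a (Icc 0 L) :=
  h.memLp.integrable one_le_two

theorem intervalIntegrable (h : UnitSpeedH2 L c τ a) : IntervalIntegrable a volume 0 L :=
  intervalIntegrable_of_integrableOn_Icc h.pos.le h.integrableOn

theorem integrableOn_sq (h : UnitSpeedH2 L c τ a) : IntegrableOn (fun s => ‖a s‖ ^ 2) (Icc 0 L) :=
  h.memLp.integrable_norm_pow two_ne_zero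

theorem continuousOn_tangent (h : UnitSpeedH2 L c τ a) : ContinuousOn τ (Icc 0 L) := by
  have h1 : ContinuousOn (fun s => ∫ y in (0 : ℝ)..s, a y) (Icc 0 L) := by
    have := intervalIntegral.continuousOn_primitive_interval (μ := volume) (f := a) (a := 0)
      (b := L) (by rw [uIcc_of_le h.pos.le]; exact h.integrableOn)
    rwa [uIcc_of_le h.pos.le] at this
  exact (continuousOn_const.add h1).congr h.tangent_eq

theorem ae_hasDerivWithinAt_tangent (h : UnitSpeedH2 L c τ a) :
    ∀ᵐ s, s ∈ Icc 0 L → HasDerivWithinAt τ (a s) (Icc 0 L) s := by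
  filter_upwards [h.intervalIntegrable.ae_hasDerivAt_integral] with s hs hsL
  rw [uIcc_of_le h.pos.le] at hs
  have h1 := ((hs hsL 0 ⟨le_rfl, h.pos.le⟩).const_add (τ 0)).hasDerivWithinAt (s := Icc 0 L)
  exact h1.congr h.tangent_eq (h.tangent_eq s hsL)

theorem ae_inner_tangent_curvature (h : UnitSpeedH2 L c τ a) :
    ∀ᵐ s, s ∈ Icc 0 L → (inner ℝ (τ s) (a s) : ℝ) = 0 := by
  filter_upwards [h.ae_hasDerivWithinAt_tangent] with s hs hsL
  have h1 := (hs hsL).inner ℝ (hs hsL)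
  have hunit : ∀ t ∈ Icc 0 L, (inner ℝ (τ t) (τ t) : ℝ) = 1 := fun t ht => by
    rw [real_inner_self_eq_norm_sq, h.unit t ht, one_pow]
  have h2 : HasDerivWithinAt (fun t => (inner ℝ (τ t) (τ t) : ℝ)) 0 (Icc 0 L) s :=
    (hasDerivWithinAt_const s (Icc 0 L) (1 : ℝ)).congr hunit (hunit s hsL)
  have h3 := (uniqueDiffOn_Icc h.pos s hsL).eq_deriv _ h1 h2
  rw [real_inner_comm (τ s) (a s)] at h3
  linarith

end UnitSpeedH2

variable {L : ℝ} {V W A B : ℝ → Plane}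

theorem aemeasurable_of_continuousOn_Icc {E : Type*} [NormedAddCommGroup E]
    [MeasurableSpace E] [BorelSpace E] {f : ℝ → E} (hL : 0 ≤ L) (hf : ContinuousOn f (Icc 0 L)) :
    AEMeasurable f (volume.restrict (uIoc 0 L)) := by
  rw [uIoc_of_le hL]
  exact (hf.mono Ioc_subset_Icc_self).aemeasurable measurableSet_Ioc

theorem aemeasurable_rot_comp {μ : Measure ℝ} {f : ℝ → Plane} (hf : AEMeasurable f μ) :
    AEMeasurable (fun s => rot (f s)) μ :=
  rotL.continuous.measurable.comp_aemeasurable hf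

theorem hasDerivAt_integral_bendingDensity (hL : 0 < L) (hV : ContinuousOn V (Icc 0 L))
    (hV1 : ∀ s ∈ Icc 0 L, ‖V s‖ = 1) (hW : ContinuousOn W (Icc 0 L))
    (hB : ContinuousOn B (Icc 0 L)) (hA : MemLp A 2 (volume.restrict (Icc 0 L))) :
    IntervalIntegrable (fun s => bendingDensityDeriv (V s) (A s) (W s) (B s)) volume 0 L ∧
    HasDerivAt (fun ε : ℝ => ∫ s in (0 : ℝ)..L, bendingDensity (V s + ε • W s) (A s + ε • B s))
      (∫ s in (0 : ℝ)..L, bendingDensityDeriv (V s) (A s) (W s) (B s)) 0 := by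
  obtain ⟨M₁, hM₁⟩ := isCompact_Icc.exists_bound_of_continuousOn hW
  obtain ⟨M₂, hM₂⟩ := isCompact_Icc.exists_bound_of_continuousOn hB
  set M := max M₁ M₂
  have hM0 : 0 ≤ M := (norm_nonneg _).trans ((hM₁ 0 ⟨le_rfl, hL.le⟩).trans (le_max_left _ _))
  set δ := 1 / (2 * (M + 1)) with hδ
  have hδ0 : 0 < δ := by positivity
  have hball : ∀ {ε : ℝ}, ε ∈ Metric.ball (0 : ℝ) δ → |ε| ≤ δ := fun hε =>
    (mem_ball_zero_iff.1 hε).le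
  have hmV := aemeasurable_of_continuousOn_Icc hL.le hV
  have hmW := aemeasurable_of_continuousOn_Icc hL.le hW
  have hmB := aemeasurable_of_continuousOn_Icc hL.le hB
  have hmA : AEMeasurable A (volume.restrict (uIoc 0 L)) := by
    rw [uIoc_of_le hL.le]
    exact hA.aestronglyMeasurable.aemeasurable.mono_measure
      (Measure.restrict_mono Ioc_subset_Icc_self le_rfl)
  have hmem : ∀ {s : ℝ}, s ∈ uIoc 0 L → s ∈ Icc 0 L := fun hs => by
    rw [uIoc_of_le hL.le] at hs; exact Ioc_subset_Icc_self hs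
  have hmeas : ∀ ε : ℝ, AEStronglyMeasurable
      (fun s => bendingDensity (V s + ε • W s) (A s + ε • B s))
      (volume.restrict (uIoc 0 L)) := fun ε => by
    have h1 := hmV.add (hmW.const_smul ε)
    have h2 := hmA.add (hmB.const_smul ε)
    exact (((h2.inner (aemeasurable_rot_comp h1)).pow_const 2).div
      (h1.norm.pow_const 5)).aestronglyMeasurable
  have hA2 : IntegrableOn (fun s => ‖A s‖ ^ 2) (Icc 0 L) := hA.integrable_norm_pow two_ne_zero
  have hint0 : IntervalIntegrable
      (fun s => bendingDensity (V s + (0 : ℝ) • W s) (A s + (0 : ℝ) • B s)) volume 0 L := by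
    have hA2' := intervalIntegrable_of_integrableOn_Icc hL.le hA2
    refine hA2'.mono_fun (hmeas 0) ?_
    rw [Filter.EventuallyLE, ae_restrict_iff' measurableSet_uIoc]
    refine Filter.Eventually.of_forall fun s hs => ?_
    have h1 := abs_inner_rot_le (V s) (A s)
    rw [hV1 s (hmem hs), mul_one] at h1
    simp only [zero_smul, add_zero, bendingDensity, hV1 s (hmem hs), one_pow, div_one, norm_pow,
      norm_norm]
    gcongr
    exact h1
  have hbd : IntervalIntegrable (fun s => 6000 * M * (‖A s‖ + 3) ^ 2) volume 0 L := by
    refine (intervalIntegrable_of_integrableOn_Icc hL.le ?_).const_mul _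
    have h1 : IntegrableOn (fun s => ‖A s‖) (Icc 0 L) := (hA.integrable one_le_two).norm
    have h2 : IntegrableOn (fun _ : ℝ => (9 : ℝ)) (Icc 0 L) := continuousOn_const.integrableOn_Icc
    refine ((hA2.add (h1.const_mul 6)).add h2).congr (Filter.Eventually.of_forall fun s => ?_)
    simp only [Pi.add_apply]
    ring
  have key := intervalIntegral.hasDerivAt_integral_of_dominated_loc_of_deriv_le (μ := volume)
    (F := fun ε s => bendingDensity (V s + ε • W s) (A s + ε • B s))
    (F' := fun ε s => bendingDensityDeriv (V s + ε • W s) (A s + ε • B s) (W s) (B s))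
    (x₀ := (0 : ℝ)) (Metric.ball_mem_nhds 0 hδ0) (Filter.Eventually.of_forall hmeas) hint0
    (by
      have h1 := hmV.add (hmW.const_smul (0 : ℝ))
      have h2 := hmA.add (hmB.const_smul (0 : ℝ))
      have h3 := h2.inner (𝕜 := ℝ) (aemeasurable_rot_comp h1)
      have h4 := (hmB.inner (𝕜 := ℝ) (aemeasurable_rot_comp h1)).add
        (h2.inner (𝕜 := ℝ) (aemeasurable_rot_comp hmW))
      exact ((((h3.const_mul 2).mul h4).div (h1.norm.pow_const 5)).sub
        ((((h3.pow_const 2).const_mul 5).mul (h1.inner (𝕜 := ℝ) hmW)).div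
          (h1.norm.pow_const 7))).aestronglyMeasurable)
    (Filter.Eventually.of_forall fun s hs ε hε =>
      abs_bendingDensityDeriv_affine_le (hV1 s (hmem hs))
        ((hM₁ s (hmem hs)).trans (le_max_left _ _))
        ((hM₂ s (hmem hs)).trans (le_max_right _ _))
        (hball hε))
    hbd
    (Filter.Eventually.of_forall fun s hs ε hε =>
      hasDerivAt_bendingDensity_affine (norm_pos_iff.1 (lt_of_lt_of_le one_half_pos
        (norm_affine_bounds (hV1 s (hmem hs)) ((hM₁ s (hmem hs)).trans (le_max_left _ M₂))
          (hball hε)).1)))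
  simpa only [zero_smul, add_zero] using key

theorem hasDerivAt_integral_norm (hL : 0 < L) (hV : ContinuousOn V (Icc 0 L))
    (hV1 : ∀ s ∈ Icc 0 L, ‖V s‖ = 1) (hW : ContinuousOn W (Icc 0 L)) :
    IntervalIntegrable (fun s => (inner ℝ (V s) (W s) : ℝ)) volume 0 L ∧
    HasDerivAt (fun ε : ℝ => ∫ s in (0 : ℝ)..L, ‖V s + ε • W s‖)
      (∫ s in (0 : ℝ)..L, (inner ℝ (V s) (W s) : ℝ)) 0 := by
  obtain ⟨M, hM⟩ := isCompact_Icc.exists_bound_of_continuousOn hW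
  have hM0 : 0 ≤ M := (norm_nonneg _).trans (hM 0 ⟨le_rfl, hL.le⟩)
  set δ := 1 / (2 * (M + 1)) with hδ
  have hδ0 : 0 < δ := by positivity
  have hball : ∀ {ε : ℝ}, ε ∈ Metric.ball (0 : ℝ) δ → |ε| ≤ δ := fun hε =>
    (mem_ball_zero_iff.1 hε).le
  have hmem : ∀ {s : ℝ}, s ∈ uIoc 0 L → s ∈ Icc 0 L := fun hs => by
    rw [uIoc_of_le hL.le] at hs; exact Ioc_subset_Icc_self hs
  have hcont : ∀ ε : ℝ, ContinuousOn (fun s => ‖V s + ε • W s‖) (Icc 0 L) := fun ε =>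
    (hV.add (hW.const_smul ε)).norm
  have hint : IntervalIntegrable (fun s => (inner ℝ (V s) (W s) : ℝ)) volume 0 L :=
    intervalIntegrable_of_integrableOn_Icc hL.le (hV.inner hW).integrableOn_Icc
  refine ⟨hint, ?_⟩
  have hne : ∀ s ∈ uIoc 0 L, ∀ ε ∈ Metric.ball (0 : ℝ) δ, V s + ε • W s ≠ 0 := fun s hs ε hε =>
    norm_pos_iff.1 (lt_of_lt_of_le one_half_pos (norm_affine_bounds (hV1 s (hmem hs))
      (hM s (hmem hs)) (hball hε)).1)
  have key := intervalIntegral.hasDerivAt_integral_of_dominated_loc_of_deriv_le (μ := volume)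
    (F := fun ε s => ‖V s + ε • W s‖)
    (F' := fun ε s => (inner ℝ (V s + ε • W s) (W s) : ℝ) / ‖V s + ε • W s‖)
    (bound := fun _ => M)
    (x₀ := (0 : ℝ)) (Metric.ball_mem_nhds 0 hδ0)
    (Filter.Eventually.of_forall fun ε =>
      (aemeasurable_of_continuousOn_Icc hL.le (hcont ε)).aestronglyMeasurable)
    (intervalIntegrable_of_integrableOn_Icc hL.le (hcont 0).integrableOn_Icc)
    (by
      have h1 := (aemeasurable_of_continuousOn_Icc hL.le hV).add
        ((aemeasurable_of_continuousOn_Icc hL.le hW).const_smul (0 : ℝ))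
      exact ((h1.inner (𝕜 := ℝ) (aemeasurable_of_continuousOn_Icc hL.le hW)).div
        h1.norm).aestronglyMeasurable)
    (Filter.Eventually.of_forall fun s hs ε hε => by
      have hpos : 0 < ‖V s + ε • W s‖ := norm_pos_iff.2 (hne s hs ε hε)
      rw [Real.norm_eq_abs, abs_div, abs_of_pos hpos, div_le_iff₀ hpos]
      refine (abs_real_inner_le_norm _ _).trans ?_
      rw [mul_comm]
      gcongr
      exact hM s (hmem hs))
    intervalIntegrable_const
    (Filter.Eventually.of_forall fun s hs ε hε => hasDerivAt_norm_affine (hne s hs ε hε))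
  convert! key.2 using 1
  refine intervalIntegral.integral_congr_ae (Filter.Eventually.of_forall fun s hs => ?_)
  simp [hV1 s (hmem hs)]

/-- The first variation of the elastic energy of a unit speed curve. -/
theorem UnitSpeedH2.hasDerivAt_elasticEnergy {c τ a ψ : ℝ → Plane} (h : UnitSpeedH2 L c τ a)
    (hψ : ContDiffOn ℝ ∞ ψ (Icc 0 L)) :
    HasDerivAt (fun ε : ℝ => elasticEnergy L fun s => c s + ε • ψ s)
      (∫ s in (0 : ℝ)..L, (2 * inner ℝ (a s) (dds L (dds L ψ) s)
        + (1 - 3 * ‖a s‖ ^ 2) * inner ℝ (τ s) (dds L ψ s))) 0 := by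
  have hu := uniqueDiffOn_Icc h.pos
  have hψ1 : ContDiffOn ℝ ∞ (dds L ψ) (Icc 0 L) :=
    ((contDiffOn_infty_iff_derivWithin hu).1 hψ).2
  have hψ2 : ContDiffOn ℝ ∞ (dds L (dds L ψ)) (Icc 0 L) :=
    ((contDiffOn_infty_iff_derivWithin hu).1 hψ1).2
  have hd1 : ∀ s ∈ Icc 0 L, HasDerivWithinAt ψ (dds L ψ s) (Icc 0 L) s := fun s hs =>
    (hψ.differentiableOn (by simp) s hs).hasDerivWithinAt
  have hd2 : ∀ s ∈ Icc 0 L, HasDerivWithinAt (dds L ψ) (dds L (dds L ψ) s) (Icc 0 L) s :=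
    fun s hs => (hψ1.differentiableOn (by simp) s hs).hasDerivWithinAt
  have hdds : ∀ ε : ℝ, ∀ s ∈ Icc 0 L,
      dds L (fun s => c s + ε • ψ s) s = τ s + ε • dds L ψ s := fun ε s hs =>
    ((h.curve_deriv s hs).add ((hd1 s hs).const_smul ε)).derivWithin (hu s hs)
  obtain ⟨hi1, hb⟩ := hasDerivAt_integral_bendingDensity h.pos h.continuousOn_tangent h.unit
    hψ1.continuousOn hψ2.continuousOn h.memLp
  obtain ⟨hi2, hn⟩ := hasDerivAt_integral_norm h.pos h.continuousOn_tangent h.unit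
    hψ1.continuousOn
  have hmem : ∀ {s : ℝ}, s ∈ uIoc 0 L → s ∈ Icc 0 L := fun hs => by
    rw [uIoc_of_le h.pos.le] at hs; exact Ioc_subset_Icc_self hs
  have hsum := hb.add hn
  rw [← intervalIntegral.integral_add hi1 hi2] at hsum
  convert! hsum using 1
  · funext ε
    rw [elasticEnergy, Pi.add_apply]
    congr 1
    · refine intervalIntegral.integral_congr_ae ?_
      -- The second derivative of the varied curve exists only almost everywhere, which is enough
      -- under the integral.
      filter_upwards [h.ae_hasDerivWithinAt_tangent] with s hs hsL
      have hs' := hmem hsL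
      have h2 : dds L (dds L fun s => c s + ε • ψ s) s = a s + ε • dds L (dds L ψ) s := by
        rw [dds_congr (hdds ε) hs']
        exact ((hs hs').add ((hd2 s hs').const_smul ε)).derivWithin (hu s hs')
      rw [curvatureVec, h2, hdds ε s hs', norm_curvatureVec_sq_mul]
    · refine intervalIntegral.integral_congr_ae (Filter.Eventually.of_forall fun s hs => ?_)
      simp only [hdds ε s (hmem hs)]
  · refine intervalIntegral.integral_congr_ae ?_
    -- At unit speed `a = kν`, so the bending part is `2k(⟨ψ'', ν⟩ + k⟨τ, ψ'⟩) - 5k²⟨τ, ψ'⟩`; this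
    -- is where the coefficient `-3` arises.
    filter_upwards [h.ae_inner_tangent_curvature] with s hs hsL
    have hs' := hmem hsL
    have h1 : (inner ℝ (τ s) (τ s) : ℝ) = 1 := by
      rw [real_inner_self_eq_norm_sq, h.unit s hs', one_pow]
    have h2 := eq_inner_rot_smul_rot h1 (hs hs')
    set k : ℝ := inner ℝ (a s) (rot (τ s))
    have h3 : ‖a s‖ ^ 2 = k ^ 2 := by
      rw [h2, norm_smul, norm_rot, h.unit s hs', mul_one, Real.norm_eq_abs, sq_abs]
    have h4 : (inner ℝ (a s) (rot (dds L ψ s)) : ℝ) = k * inner ℝ (τ s) (dds L ψ s) := by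
      conv_lhs => rw [h2]
      rw [real_inner_smul_left, inner_rot_rot]
    have h5 : (inner ℝ (a s) (dds L (dds L ψ) s) : ℝ)
        = k * inner ℝ (dds L (dds L ψ) s) (rot (τ s)) := by
      conv_lhs => rw [h2]
      rw [real_inner_smul_left, real_inner_comm]
    rw [bendingDensityDeriv, h3, h4, h5, h.unit s hs']
    ring

end ElasticNetwork

/-! ### Du Bois-Reymond lemma -/

/-- Extending `f` constantly beyond `[0, L]` makes it continuous on the line, so the fundamental
theorem of calculus holds up to the endpoints. -/
theorem hasDerivWithinAt_integral_Icc {E : Type*} [NormedAddCommGroup E] [NormedSpace ℝ E]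
    [CompleteSpace E] {f : ℝ → E} {L : ℝ} (hL : 0 ≤ L) (hf : ContinuousOn f (Icc 0 L)) {s : ℝ}
    (hs : s ∈ Icc 0 L) :
    HasDerivWithinAt (fun x => ∫ y in (0 : ℝ)..x, f y) (f s) (Icc 0 L) s := by
  set g : ℝ → E := fun x => f (projIcc 0 L hL x)
  have hg : Continuous g := by
    have := (continuousOn_iff_continuous_domRestrict.1 hf).comp (continuous_projIcc (h := hL))
    exact this
  have hfg : EqOn f g (Icc 0 L) := fun x hx => by simp [g, projIcc_of_mem hL hx]
  have heq : ∀ x ∈ Icc 0 L, ∫ y in (0 : ℝ)..x, f y = ∫ y in (0 : ℝ)..x, g y := fun x hx =>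
    intervalIntegral.integral_congr fun y hy => by
      rw [uIcc_of_le hx.1] at hy
      exact hfg ⟨hy.1, hy.2.trans hx.2⟩
  rw [hfg hs]
  exact (hg.integral_hasStrictDerivAt 0 s).hasDerivAt.hasDerivWithinAt.congr heq (heq s hs)

/-- Du Bois-Reymond lemma of second order. -/
theorem exists_ae_eq_affine_of_integral_mul_deriv_deriv_eq_zero {L : ℝ} (hL : 0 < L) {f : ℝ → ℝ}
    (hf : IntegrableOn f (Icc 0 L))
    (h : ∀ φ : ℝ → ℝ, ContDiff ℝ ∞ φ → φ 0 = 0 → φ L = 0 → deriv φ 0 = 0 → deriv φ L = 0 →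
      ∫ s in (0 : ℝ)..L, f s * deriv (deriv φ) s = 0) :
    ∃ p q : ℝ, ∀ᵐ s, s ∈ Ioo 0 L → f s = p + q * s := by
  have hfi : IntervalIntegrable f volume 0 L :=
    (intervalIntegrable_iff_integrableOn_Icc_of_le hL.le).2 hf
  set I₀ := ∫ s in (0 : ℝ)..L, f s
  set I₁ := ∫ s in (0 : ℝ)..L, f s * s
  -- With `α`, `β`, `A`, `B` below, `2αI₀ + 6βI₁ = XA + YB`, while `A = ∫ (L - s) g` and `B = ∫ g`.
  -- Hence the affine function must be `X(L - s) + Y`.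
  set X := 6 * I₀ / L ^ 2 - 12 * I₁ / L ^ 3
  set Y := -2 * I₀ / L + 6 * I₁ / L ^ 2
  refine ⟨X * L + Y, -X, ?_⟩
  have hcont : Continuous fun s : ℝ => X * L + Y + -X * s := by fun_prop
  have hloc : LocallyIntegrableOn (fun s => f s - (X * L + Y + -X * s)) (Ioo 0 L) :=
    ((hf.sub hcont.continuousOn.integrableOn_Icc).mono_set Ioo_subset_Icc_self).locallyIntegrableOn
  have key := isOpen_Ioo.ae_eq_zero_of_integral_contDiff_smul_eq_zero hloc ?_
  · filter_upwards [key] with s hs hs'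
    exact sub_eq_zero.1 (hs hs')
  intro g hg _ hgs
  have hgc : Continuous g := hg.continuous
  set G₁ : ℝ → ℝ := fun s => ∫ y in (0 : ℝ)..s, g y with hG₁
  set G₂ : ℝ → ℝ := fun s => ∫ y in (0 : ℝ)..s, G₁ y with hG₂
  have hd1 : ∀ s, HasDerivAt G₁ (g s) s := fun s => (hgc.integral_hasStrictDerivAt 0 s).hasDerivAt
  have hG₁c : Continuous G₁ := continuous_iff_continuousAt.2 fun s => (hd1 s).continuousAt
  have hd2 : ∀ s, HasDerivAt G₂ (G₁ s) s := fun s =>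
    (hG₁c.integral_hasStrictDerivAt 0 s).hasDerivAt
  have hG₁s : ContDiff ℝ ∞ G₁ := contDiff_infty_iff_deriv.2
    ⟨fun s => (hd1 s).differentiableAt, by rwa [funext fun s => (hd1 s).deriv]⟩
  have hG₂s : ContDiff ℝ ∞ G₂ := contDiff_infty_iff_deriv.2
    ⟨fun s => (hd2 s).differentiableAt, by rwa [funext fun s => (hd2 s).deriv]⟩
  set A := G₂ L
  set B := G₁ L
  -- The cubic `αs² + βs³` has value `A` and slope `B` at `L` and vanishes to first order at `0`;
  -- subtracting it from the second primitive of `g` gives an admissible test function.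
  set α := 3 * A / L ^ 2 - B / L
  set β := B / L ^ 2 - 2 * A / L ^ 3
  set φ : ℝ → ℝ := fun s => G₂ s - (α * s ^ 2 + β * s ^ 3) with hφ
  have hφ1 : ∀ s, HasDerivAt φ (G₁ s - (α * (2 * s) + β * (3 * s ^ 2))) s := fun s => by
    have h1 := ((hasDerivAt_pow 2 s).const_mul α).add ((hasDerivAt_pow 3 s).const_mul β)
    exact ((hd2 s).sub h1).congr_deriv (by simp)
  have hdφ : deriv φ = fun s => G₁ s - (α * (2 * s) + β * (3 * s ^ 2)) :=
    funext fun s => (hφ1 s).deriv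
  have hφ2 : ∀ s, HasDerivAt (deriv φ) (g s - (α * 2 + β * (3 * (2 * s)))) s := fun s => by
    rw [hdφ]
    have h1 := (((hasDerivAt_id s).const_mul 2).const_mul α).add
      (((hasDerivAt_pow 2 s).const_mul 3).const_mul β)
    exact ((hd1 s).sub h1).congr_deriv (by simp)
  have hG₁0 : G₁ 0 = 0 := by simp [hG₁]
  have hG₂0 : G₂ 0 = 0 := by simp [hG₂]
  have hL0 : L ≠ 0 := hL.ne'
  have hzero := h φ (hG₂s.sub (by fun_prop)) (by simp [hφ, hG₂0])
    (by simp only [hφ, α, β, A]; field_simp; ring)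
    (by simp [hdφ, hG₁0])
    (by simp only [hdφ, α, β, B]; field_simp; ring)
  have hfg : IntervalIntegrable (fun s => f s * g s) volume 0 L :=
    hfi.mul_continuousOn hgc.continuousOn
  have hfs : IntervalIntegrable (fun s => f s * s) volume 0 L :=
    hfi.mul_continuousOn continuousOn_id
  have hfg' : ∫ s in (0 : ℝ)..L, f s * g s = 2 * α * I₀ + 6 * β * I₁ := by
    have : ∀ s, f s * deriv (deriv φ) s = f s * g s - (2 * α * f s + 6 * β * (f s * s)) :=
      fun s => by rw [(hφ2 s).deriv]; ring
    simp only [this] at hzero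
    rw [intervalIntegral.integral_sub hfg ((hfi.const_mul _).add (hfs.const_mul _)),
      intervalIntegral.integral_add (hfi.const_mul _) (hfs.const_mul _),
      intervalIntegral.integral_const_mul, intervalIntegral.integral_const_mul] at hzero
    linarith
  have hA : A = L * B - ∫ s in (0 : ℝ)..L, s * g s := by
    have := intervalIntegral.integral_mul_deriv_eq_deriv_mul (a := 0) (b := L)
      (fun s _ => hasDerivAt_id s) (fun s _ => hd1 s) intervalIntegrable_const
      (hgc.intervalIntegrable 0 L)
    simp only [id, one_mul, zero_mul, sub_zero] at this
    simp only [A, B, hG₂]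
    linarith
  have hsg : IntervalIntegrable (fun s => s * g s) volume 0 L :=
    (continuous_id.mul hgc).intervalIntegrable 0 L
  have hgi : IntervalIntegrable g volume 0 L := hgc.intervalIntegrable 0 L
  have hsupp : ∫ s, g s • (f s - (X * L + Y + -X * s))
      = ∫ s in (0 : ℝ)..L, g s • (f s - (X * L + Y + -X * s)) := by
    rw [intervalIntegral.integral_of_le hL.le]
    refine (setIntegral_eq_integral_of_forall_compl_eq_zero fun s hs => ?_).symm
    rw [image_eq_zero_of_notMem_tsupport fun hs' => hs (Ioo_subset_Ioc_self (hgs hs')), zero_smul]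
  rw [hsupp]
  have hpt : ∀ s, g s • (f s - (X * L + Y + -X * s))
      = f s * g s - ((X * L + Y) * g s + -X * (s * g s)) := fun s => by
    rw [smul_eq_mul]; ring
  simp only [hpt]
  rw [intervalIntegral.integral_sub hfg ((hgi.const_mul _).add (hsg.const_mul _)),
    intervalIntegral.integral_add (hgi.const_mul _) (hsg.const_mul _),
    intervalIntegral.integral_const_mul, intervalIntegral.integral_const_mul, hfg']
  have hS : ∫ s in (0 : ℝ)..L, s * g s = L * B - A := by linarith
  have hB : ∫ s in (0 : ℝ)..L, g s = B := rfl
  rw [hS, hB]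
  simp only [α, β, X, Y]
  field_simp
  ring

/-! ### Regularity of critical curves -/

namespace ElasticNetwork

/-- The first variation of the elastic energy of a unit speed curve with tangent `τ` and curvature
vector `a` in the direction `ψ`. -/
noncomputable def firstVariation (L : ℝ) (τ a ψ : ℝ → Plane) : ℝ :=
  ∫ s in (0 : ℝ)..L, (2 * inner ℝ (a s) (dds L (dds L ψ) s)
    + (1 - 3 * ‖a s‖ ^ 2) * inner ℝ (τ s) (dds L ψ s))

theorem dds_of_hasDerivAt {L : ℝ} (hL : 0 < L) {φ : ℝ → Plane} {φ' : Plane} {s : ℝ}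
    (h : HasDerivAt φ φ' s) (hs : s ∈ Icc 0 L) : dds L φ s = φ' :=
  h.hasDerivWithinAt.derivWithin (uniqueDiffOn_Icc hL s hs)

/-- The `j`-th vector of the standard basis of the plane. -/
noncomputable def basisVec (j : Fin 2) : Plane := EuclideanSpace.single j 1

theorem inner_basisVec (v : Plane) (j : Fin 2) : (inner ℝ v (basisVec j) : ℝ) = v j := by
  simp [basisVec, EuclideanSpace.inner_single_right]

namespace UnitSpeedH2

variable {L : ℝ} {c τ a : ℝ → Plane}

theorem integrableOn_forcing (h : UnitSpeedH2 L c τ a) :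
    IntegrableOn (fun s => (1 - 3 * ‖a s‖ ^ 2) • τ s) (Icc 0 L) := by
  have h1 : IntegrableOn (fun s => 1 - 3 * ‖a s‖ ^ 2) (Icc 0 L) :=
    (continuousOn_const.integrableOn_Icc).sub (h.integrableOn_sq.const_mul 3)
  exact h1.smul_continuousOn h.continuousOn_tangent isCompact_Icc

theorem coord_integral {f : ℝ → Plane} {s t : ℝ} (hf : IntervalIntegrable f volume s t)
    (j : Fin 2) : (∫ y in s..t, f y) j = ∫ y in s..t, f y j :=
  ((EuclideanSpace.proj j : Plane →L[ℝ] ℝ).intervalIntegral_comp_comm hf).symm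

theorem integrableOn_coord {f : ℝ → Plane} {s : Set ℝ} (hf : IntegrableOn f s) (j : Fin 2) :
    IntegrableOn (fun y => f y j) s :=
  (EuclideanSpace.proj j : Plane →L[ℝ] ℝ).integrable_comp hf

theorem firstVariation_coord (h : UnitSpeedH2 L c τ a) {φ : ℝ → ℝ} (hφ : ContDiff ℝ ∞ φ)
    (j : Fin 2) :
    firstVariation L τ a (fun s => φ s • basisVec j)
      = ∫ s in (0 : ℝ)..L, (2 * (a s j * deriv (deriv φ) s)
        + deriv φ s * ((1 - 3 * ‖a s‖ ^ 2) • τ s) j) := by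
  have hφ' : ContDiff ℝ ∞ (deriv φ) := (contDiff_infty_iff_deriv.1 hφ).2
  refine intervalIntegral.integral_congr fun s hs => ?_
  rw [uIcc_of_le h.pos.le] at hs
  have hd1 : ∀ t ∈ Icc 0 L, dds L (fun s => φ s • basisVec j) t = deriv φ t • basisVec j :=
    fun t ht => dds_of_hasDerivAt h.pos
      ((hφ.differentiable (by simp) t).hasDerivAt.smul_const _) ht
  have hd2 : dds L (dds L fun s => φ s • basisVec j) s = deriv (deriv φ) s • basisVec j := by
    rw [dds_congr hd1 hs]
    exact dds_of_hasDerivAt h.pos ((hφ'.differentiable (by simp) s).hasDerivAt.smul_const _) hs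
  simp only [hd2, hd1 s hs, real_inner_smul_right, inner_basisVec, PiLp.smul_apply, smul_eq_mul]
  ring

/-- Integration by parts with `b` only in `L¹`, possible because its primitive is absolutely
continuous. It is applied to a derivative `φ'`, which moves the forcing term onto `φ''`. -/
theorem integral_mul_forcing {b : ℝ → ℝ} (hL : 0 < L) (hb : IntegrableOn b (Icc 0 L))
    {φ : ℝ → ℝ} (hφ : ContDiff ℝ ∞ φ) (h0 : φ 0 = 0) (hL0 : φ L = 0) :
    ∫ s in (0 : ℝ)..L, φ s * b s
      = -∫ s in (0 : ℝ)..L, deriv φ s * ∫ y in (0 : ℝ)..s, b y := by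
  have hbi := intervalIntegrable_of_integrableOn_Icc hL.le hb
  have hac := hbi.absolutelyContinuousOnInterval_intervalIntegral (c := 0) left_mem_uIcc
  have hφac : AbsolutelyContinuousOnInterval φ 0 L :=
    (hφ.of_le (by exact_mod_cast le_top)).contDiffOn.absolutelyContinuousOnInterval
  have key := hφac.integral_mul_deriv_eq_deriv_mul hac
  rw [h0, hL0, zero_mul, zero_mul, sub_zero, zero_sub] at key
  rw [← key]
  refine intervalIntegral.integral_congr_ae ?_
  filter_upwards [hbi.ae_hasDerivAt_integral] with s hs hsL
  rw [(hs (uIoc_subset_uIcc hsL) 0 left_mem_uIcc).deriv]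

/-- Regularity: a unit speed `H²` curve whose first variation vanishes in all directions that
vanish to first order at the endpoints solves the elastica equation. -/
theorem exists_isElastica (h : UnitSpeedH2 L c τ a)
    (hcrit : ∀ ψ : ℝ → Plane, ContDiff ℝ ∞ ψ → ψ 0 = 0 → ψ L = 0 → deriv ψ 0 = 0 →
      deriv ψ L = 0 → firstVariation L τ a ψ = 0) :
    ∃ (a' : ℝ → Plane) (F : Plane), IsElastica L c τ a' F ∧
      ∀ᵐ s, s ∈ Icc 0 L → a s = a' s := by
  have hb := h.integrableOn_forcing
  set b : ℝ → Plane := fun s => (1 - 3 * ‖a s‖ ^ 2) • τ s with hbdef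
  have hbi := intervalIntegrable_of_integrableOn_Icc h.pos.le hb
  have hcoord : ∀ j : Fin 2, ∃ p q : ℝ, ∀ᵐ s, s ∈ Ioo 0 L →
      2 * a s j - (∫ y in (0 : ℝ)..s, b y j) = p + q * s := by
    intro j
    have haj := integrableOn_coord h.integrableOn j
    have hbj := integrableOn_coord hb j
    have hGc : ContinuousOn (fun s => ∫ y in (0 : ℝ)..s, b y j) (Icc 0 L) := by
      have := intervalIntegral.continuousOn_primitive_interval (μ := volume)
        (f := fun y => b y j) (a := 0) (b := L) (by rw [uIcc_of_le h.pos.le]; exact hbj)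
      rwa [uIcc_of_le h.pos.le] at this
    refine exists_ae_eq_affine_of_integral_mul_deriv_deriv_eq_zero h.pos
      ((haj.const_mul 2).sub hGc.integrableOn_Icc) fun φ hφ h0 hL0 hd0 hdL => ?_
    have hφ' : ContDiff ℝ ∞ (deriv φ) := (contDiff_infty_iff_deriv.1 hφ).2
    have hφ'' : ContDiff ℝ ∞ (deriv (deriv φ)) := (contDiff_infty_iff_deriv.1 hφ').2
    have hd : ∀ s, deriv (fun s => φ s • basisVec j) s = deriv φ s • basisVec j := fun s =>
      ((hφ.differentiable (by simp) s).hasDerivAt.smul_const _).deriv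
    have hz := hcrit (fun s => φ s • basisVec j) (hφ.smul contDiff_const) (by simp [h0])
      (by simp [hL0]) (by rw [hd, hd0, zero_smul]) (by rw [hd, hdL, zero_smul])
    rw [h.firstVariation_coord hφ] at hz
    have i1 : IntervalIntegrable (fun s => 2 * (a s j * deriv (deriv φ) s)) volume 0 L :=
      ((intervalIntegrable_of_integrableOn_Icc h.pos.le haj).mul_continuousOn
        hφ''.continuous.continuousOn).const_mul 2
    have i2 : IntervalIntegrable (fun s => deriv φ s * b s j) volume 0 L :=
      (intervalIntegrable_of_integrableOn_Icc h.pos.le hbj).continuousOn_mul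
        hφ'.continuous.continuousOn
    have i3 : IntervalIntegrable (fun s => deriv (deriv φ) s * ∫ y in (0 : ℝ)..s, b y j)
        volume 0 L :=
      intervalIntegrable_of_integrableOn_Icc h.pos.le
        (hφ''.continuous.continuousOn.mul hGc).integrableOn_Icc
    rw [intervalIntegral.integral_add i1 i2, integral_mul_forcing h.pos hbj hφ' hd0 hdL,
      ← sub_eq_add_neg, ← intervalIntegral.integral_sub i1 i3] at hz
    refine (intervalIntegral.integral_congr fun s _ => ?_).trans hz
    simp only
    ring
  choose p q hpq using hcoord
  let P : Plane := !₂[p 0, p 1]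
  -- The slopes of the affine functions form the constant of the once integrated equation.
  let F : Plane := !₂[q 0, q 1]
  set a' : ℝ → Plane := fun s => (1 / 2 : ℝ) • (P + s • F + ∫ y in (0 : ℝ)..s, b y) with ha'
  have hae0 : ∀ᵐ s, s ∈ Ioo 0 L → a s = a' s := by
    filter_upwards [hpq 0, hpq 1] with s h0 h1 hs
    have hbs : IntervalIntegrable b volume 0 s := hbi.mono_set (by
      rw [uIcc_of_le hs.1.le, uIcc_of_le h.pos.le]; exact Icc_subset_Icc_right hs.2.le)
    have e0 := h0 hs
    have e1 := h1 hs
    rw [← coord_integral hbs] at e0 e1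
    refine plane_ext ?_ ?_
    · simp only [ha', P, F, PiLp.smul_apply, PiLp.add_apply, smul_eq_mul]
      simp
      linarith
    · simp only [ha', P, F, PiLp.smul_apply, PiLp.add_apply, smul_eq_mul]
      simp
      linarith
  have hae : ∀ᵐ s, s ∈ Icc 0 L → a s = a' s := by
    have n0 : ∀ᵐ s : ℝ, s ≠ 0 := by simp [ae_iff, measure_singleton]
    have nL : ∀ᵐ s : ℝ, s ≠ L := by simp [ae_iff, measure_singleton]
    filter_upwards [hae0, n0, nL] with s h1 h2 h3 hs
    exact h1 ⟨lt_of_le_of_ne hs.1 (Ne.symm h2), lt_of_le_of_ne hs.2 h3⟩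
  have hbc : ContinuousOn (fun s => ∫ y in (0 : ℝ)..s, b y) (Icc 0 L) := by
    have := intervalIntegral.continuousOn_primitive_interval (μ := volume)
      (f := b) (a := 0) (b := L) (by rw [uIcc_of_le h.pos.le]; exact hb)
    rwa [uIcc_of_le h.pos.le] at this
  have hac : ContinuousOn a' (Icc 0 L) :=
    ((by fun_prop : ContinuousOn (fun s : ℝ => P + s • F) (Icc 0 L)).add hbc).const_smul
      (1 / 2 : ℝ)
  have hsub : ∀ {s x : ℝ}, s ∈ Icc 0 L → x ∈ uIoc 0 s → x ∈ Icc 0 L := fun hs hx => by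
    rw [uIoc_of_le hs.1] at hx
    exact ⟨hx.1.le, hx.2.trans hs.2⟩
  have hτ : ∀ s ∈ Icc 0 L, τ s = τ 0 + ∫ y in (0 : ℝ)..s, a' y := fun s hs => by
    rw [h.tangent_eq s hs]
    congr 1
    refine intervalIntegral.integral_congr_ae ?_
    filter_upwards [hae] with x hx hxs using hx (hsub hs hxs)
  -- Replacing `a` by its continuous representative does not change the primitive but makes the
  -- integrand continuous, so `a'` is differentiable up to the endpoints.
  set b' : ℝ → Plane := fun s => (1 - 3 * ‖a' s‖ ^ 2) • τ s with hb'
  have hb'c : ContinuousOn b' (Icc 0 L) :=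
    (continuousOn_const.sub (continuousOn_const.mul (hac.norm.pow 2))).smul
      h.continuousOn_tangent
  have ha'' : ∀ s ∈ Icc 0 L, a' s = (1 / 2 : ℝ) • (P + s • F + ∫ y in (0 : ℝ)..s, b' y) :=
    fun s hs => by
      simp only [ha']
      congr 2
      refine intervalIntegral.integral_congr_ae ?_
      filter_upwards [hae] with x hx hxs
      simp only [hbdef, hb', hx (hsub hs hxs)]
  refine ⟨a', F, ⟨h.pos, h.curve_deriv, fun s hs => ?_, fun s hs => ?_, h.unit⟩, hae⟩
  · exact ((hasDerivWithinAt_integral_Icc h.pos.le hac hs).const_add (τ 0)).congr hτ (hτ s hs)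
  · have h1 : HasDerivWithinAt (fun s : ℝ => s • F) F (Icc 0 L) s := by
      simpa using ((hasDerivAt_id s).smul_const F).hasDerivWithinAt
    have h2 := ((h1.const_add P).add
      (hasDerivWithinAt_integral_Icc h.pos.le hb'c hs)).const_smul (1 / 2 : ℝ)
    refine (h2.congr ha'' (ha'' s hs)).congr_deriv ?_
    rw [hb', real_inner_self_eq_norm_sq]
    module

end UnitSpeedH2
end ElasticNetwork

/-! ### Curves with increments controlled by an `L²` function -/

theorem AbsolutelyContinuousOnInterval.of_dist_le {X Y : Type*} [PseudoMetricSpace X]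
    [PseudoMetricSpace Y] {f : ℝ → X} {g : ℝ → Y} {a b : ℝ}
    (hg : AbsolutelyContinuousOnInterval g a b)
    (h : ∀ x ∈ uIcc a b, ∀ y ∈ uIcc a b, dist (f x) (f y) ≤ dist (g x) (g y)) :
    AbsolutelyContinuousOnInterval f a b := by
  rw [absolutelyContinuousOnInterval_iff] at hg ⊢
  intro ε hε
  obtain ⟨δ, hδ, H⟩ := hg ε hε
  refine ⟨δ, hδ, fun E hE hEδ => lt_of_le_of_lt ?_ (H E hE hEδ)⟩
  exact Finset.sum_le_sum fun i hi => h _ (hE.1 i hi).1 _ (hE.1 i hi).2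

theorem abs_le_abs_of_hasDerivAt_of_dist_le {f g : ℝ → ℝ} {f' g' x : ℝ} (hf : HasDerivAt f f' x)
    (hg : HasDerivAt g g' x) (h : ∀ᶠ y in nhds x, dist (f y) (f x) ≤ dist (g y) (g x)) :
    |f'| ≤ |g'| := by
  refine le_of_tendsto_of_tendsto (hasDerivAt_iff_tendsto_slope.1 hf).abs
    (hasDerivAt_iff_tendsto_slope.1 hg).abs ?_
  filter_upwards [nhdsWithin_le_nhds h] with y hy
  rw [slope_def_field, slope_def_field, abs_div, abs_div]
  rw [Real.dist_eq, Real.dist_eq] at hy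
  gcongr

namespace ElasticNetwork

/-- A curve whose increments are bounded by the integral of an `L²` function is the primitive of
an `L²` function. -/
theorem exists_memLp_primitive_of_dist_le {L : ℝ} (hL : 0 < L) {f : ℝ → Plane} {q : ℝ → ℝ}
    (hq : MemLp q 2 (volume.restrict (Icc 0 L)))
    (h : ∀ x ∈ Icc 0 L, ∀ y ∈ Icc 0 L, dist (f x) (f y) ≤ |∫ u in x..y, q u|) :
    ∃ a : ℝ → Plane, MemLp a 2 (volume.restrict (Icc 0 L)) ∧
      ∀ s ∈ Icc 0 L, f s = f 0 + ∫ u in (0 : ℝ)..s, a u := by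
  have hqi : IntervalIntegrable q volume 0 L :=
    intervalIntegrable_of_integrableOn_Icc hL.le (hq.integrable one_le_two)
  set Q : ℝ → ℝ := fun s => ∫ u in (0 : ℝ)..s, q u with hQ
  have hqs : ∀ s ∈ Icc 0 L, IntervalIntegrable q volume 0 s := fun s hs =>
    hqi.mono_set (by rw [uIcc_of_le hs.1, uIcc_of_le hL.le]; exact Icc_subset_Icc_right hs.2)
  have hdist : ∀ j : Fin 2, ∀ x ∈ Icc 0 L, ∀ y ∈ Icc 0 L,
      dist (f x j) (f y j) ≤ dist (Q x) (Q y) := fun j x hx y hy => by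
    have h1 : dist (f x j) (f y j) ≤ dist (f x) (f y) := by
      rw [dist_eq_norm, dist_eq_norm]
      exact PiLp.norm_apply_le (f x - f y) j
    refine h1.trans ((h x hx y hy).trans (le_of_eq ?_))
    rw [dist_comm, Real.dist_eq, intervalIntegral.integral_interval_sub_left (hqs y hy) (hqs x hx)]
  have hQac : AbsolutelyContinuousOnInterval Q 0 L :=
    hqi.absolutelyContinuousOnInterval_intervalIntegral left_mem_uIcc
  have hac : ∀ j : Fin 2, AbsolutelyContinuousOnInterval (fun s => f s j) 0 L := fun j =>
    hQac.of_dist_le (by rw [uIcc_of_le hL.le]; exact hdist j)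
  -- Each component is absolutely continuous, hence differentiable almost everywhere; comparing
  -- difference quotients with those of `Q` bounds its derivative by `|q|`, which puts it in `L²`.
  have hderiv : ∀ j : Fin 2, ∀ᵐ s ∂volume.restrict (Icc 0 L),
      ‖deriv (fun s => f s j) s‖ ≤ ‖q s‖ := fun j => by
    rw [ae_restrict_iff' measurableSet_Icc]
    have n0 : ∀ᵐ s : ℝ, s ≠ 0 := by simp [ae_iff, measure_singleton]
    have nL : ∀ᵐ s : ℝ, s ≠ L := by simp [ae_iff, measure_singleton]
    filter_upwards [(hac j).ae_differentiableAt, hqi.ae_hasDerivAt_integral, n0, nL]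
      with s h1 h2 h3 h4 hs
    have hsu : s ∈ uIcc 0 L := by rwa [uIcc_of_le hL.le]
    refine abs_le_abs_of_hasDerivAt_of_dist_le (h1 hsu).hasDerivAt (h2 hsu 0 left_mem_uIcc) ?_
    filter_upwards [Icc_mem_nhds (lt_of_le_of_ne hs.1 (Ne.symm h3)) (lt_of_le_of_ne hs.2 h4)]
      with y hy using hdist j y hy s hs
  have hmem : ∀ j : Fin 2, MemLp (fun s => deriv (fun s => f s j) s • basisVec j) 2
      (volume.restrict (Icc 0 L)) := fun j => by
    have h1 : MemLp (deriv fun s => f s j) 2 (volume.restrict (Icc 0 L)) :=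
      hq.mono (measurable_deriv _).aestronglyMeasurable (hderiv j)
    exact (ContinuousLinearMap.toSpanSingleton ℝ (basisVec j)).comp_memLp' h1
  refine ⟨fun s => deriv (fun s => f s 0) s • basisVec 0 + deriv (fun s => f s 1) s • basisVec 1,
    (hmem 0).add (hmem 1), fun s hs => ?_⟩
  have hsub : uIcc 0 s ⊆ uIcc 0 L := by
    rw [uIcc_of_le hs.1, uIcc_of_le hL.le]; exact Icc_subset_Icc_right hs.2
  have hint : ∀ j : Fin 2, IntervalIntegrable (fun s => deriv (fun s => f s j) s • basisVec j)
      volume 0 s := fun j =>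
    (intervalIntegrable_of_integrableOn_Icc hL.le ((hmem j).integrable one_le_two)).mono_set hsub
  have hftc : ∀ j : Fin 2, ∫ u in (0 : ℝ)..s, deriv (fun s => f s j) u = f s j - f 0 j := fun j =>
    ((hac j).mono hsub).integral_deriv_eq_sub
  rw [intervalIntegral.integral_add (hint 0) (hint 1), intervalIntegral.integral_smul_const,
    intervalIntegral.integral_smul_const, hftc, hftc]
  refine plane_ext ?_ ?_ <;> simp [basisVec]

end ElasticNetwork

/-! ### Arclength parametrization of an `H²` immersion -/

namespace ElasticNetwork

/-- The inverse of the arclength function of a regular curve on `[0, 1]`. -/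
noncomputable def arcInv (γ : ℝ → Plane) (s : ℝ) : ℝ :=
  Function.invFunOn (arclength γ) (Icc 0 1) s

namespace IsRegularCurve

variable {γ : ℝ → Plane}

theorem hasDerivWithinAt (h : IsRegularCurve 1 γ) {x : ℝ} (hx : x ∈ Icc (0 : ℝ) 1) :
    HasDerivWithinAt γ (dds 1 γ x) (Icc 0 1) x :=
  (h.1.1 x hx).hasDerivWithinAt

theorem continuousOn_dds (h : IsRegularCurve 1 γ) : ContinuousOn (dds 1 γ) (Icc 0 1) := by
  obtain ⟨g, hg, hgx⟩ := h.1.2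
  have h1 : ContinuousOn (fun s => ∫ y in (0 : ℝ)..s, g y) (Icc 0 1) := by
    have := intervalIntegral.continuousOn_primitive_interval (μ := volume) (f := g) (a := 0)
      (b := 1) (by rw [uIcc_of_le zero_le_one]; exact hg.integrable one_le_two)
    rwa [uIcc_of_le zero_le_one] at this
  exact (continuousOn_const.add h1).congr hgx

theorem exists_speed_bound (h : IsRegularCurve 1 γ) :
    ∃ m : ℝ, 0 < m ∧ ∀ x ∈ Icc (0 : ℝ) 1, m ≤ ‖dds 1 γ x‖ := by
  obtain ⟨x, hx, hmin⟩ := isCompact_Icc.exists_isMinOn (nonempty_Icc.2 zero_le_one)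
    h.continuousOn_dds.norm
  exact ⟨‖dds 1 γ x‖, norm_pos_iff.2 (h.2 x hx), fun y hy => hmin hy⟩

theorem intervalIntegrable_speed (h : IsRegularCurve 1 γ) {x y : ℝ} (hx : x ∈ Icc (0 : ℝ) 1)
    (hy : y ∈ Icc (0 : ℝ) 1) : IntervalIntegrable (fun u => ‖dds 1 γ u‖) volume x y :=
  (h.continuousOn_dds.norm.mono
    ((convex_Icc (0 : ℝ) 1).ordConnected.uIcc_subset hx hy)).intervalIntegrable

theorem hasDerivWithinAt_arclength (h : IsRegularCurve 1 γ) {x : ℝ} (hx : x ∈ Icc (0 : ℝ) 1) :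
    HasDerivWithinAt (arclength γ) ‖dds 1 γ x‖ (Icc 0 1) x :=
  hasDerivWithinAt_integral_Icc zero_le_one h.continuousOn_dds.norm hx

theorem arclength_zero : arclength γ 0 = 0 := intervalIntegral.integral_same

/-- The speed has a positive lower bound by compactness. The resulting expansion of arclength yields
positive length and a strictly increasing Lipschitz inverse. -/
theorem mul_sub_le_arclength_sub (h : IsRegularCurve 1 γ) {m : ℝ}
    (hm : ∀ x ∈ Icc (0 : ℝ) 1, m ≤ ‖dds 1 γ x‖) {x y : ℝ} (hx : x ∈ Icc (0 : ℝ) 1)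
    (hy : y ∈ Icc (0 : ℝ) 1) (hxy : x ≤ y) : m * (y - x) ≤ arclength γ y - arclength γ x := by
  have h0 : (0 : ℝ) ∈ Icc (0 : ℝ) 1 := ⟨le_rfl, zero_le_one⟩
  have h1 : arclength γ y - arclength γ x = ∫ u in x..y, ‖dds 1 γ u‖ :=
    intervalIntegral.integral_interval_sub_left (h.intervalIntegrable_speed h0 hy)
      (h.intervalIntegrable_speed h0 hx)
  have h2 : ∫ _ in x..y, m = m * (y - x) := by simp [mul_comm]
  rw [h1, ← h2]
  exact intervalIntegral.integral_mono_on hxy intervalIntegrable_const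
    (h.intervalIntegrable_speed hx hy) fun u hu => hm u ⟨hx.1.trans hu.1, hu.2.trans hy.2⟩

theorem curveLength_pos (h : IsRegularCurve 1 γ) : 0 < curveLength γ := by
  obtain ⟨m, hm0, hm⟩ := h.exists_speed_bound
  have := h.mul_sub_le_arclength_sub hm (x := 0) (y := 1) ⟨le_rfl, zero_le_one⟩
    ⟨zero_le_one, le_rfl⟩ zero_le_one
  rw [arclength_zero] at this
  rw [curveLength]
  linarith

theorem exists_arclength_eq (h : IsRegularCurve 1 γ) {s : ℝ} (hs : s ∈ Icc 0 (curveLength γ)) :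
    ∃ x ∈ Icc (0 : ℝ) 1, arclength γ x = s := by
  have hc : ContinuousOn (arclength γ) (Icc 0 1) := fun x hx =>
    (h.hasDerivWithinAt_arclength hx).continuousWithinAt
  have := intermediate_value_Icc zero_le_one hc
  rw [arclength_zero] at this
  exact this hs

theorem arcInv_mem (h : IsRegularCurve 1 γ) {s : ℝ} (hs : s ∈ Icc 0 (curveLength γ)) :
    arcInv γ s ∈ Icc (0 : ℝ) 1 :=
  Function.invFunOn_mem (h.exists_arclength_eq hs)

theorem arclength_arcInv (h : IsRegularCurve 1 γ) {s : ℝ} (hs : s ∈ Icc 0 (curveLength γ)) :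
    arclength γ (arcInv γ s) = s :=
  Function.invFunOn_eq (h.exists_arclength_eq hs)

theorem arcInv_strictMonoOn (h : IsRegularCurve 1 γ) :
    StrictMonoOn (arcInv γ) (Icc 0 (curveLength γ)) := by
  obtain ⟨m, hm0, hm⟩ := h.exists_speed_bound
  intro s hs s' hs' hss'
  by_contra! hle
  have := h.mul_sub_le_arclength_sub hm (h.arcInv_mem hs') (h.arcInv_mem hs) hle
  rw [h.arclength_arcInv hs, h.arclength_arcInv hs'] at this
  have h2 : 0 ≤ m * (arcInv γ s - arcInv γ s') := mul_nonneg hm0.le (sub_nonneg.2 hle)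
  linarith

theorem arcInv_lipschitz (h : IsRegularCurve 1 γ) {m : ℝ} (hm0 : 0 < m)
    (hm : ∀ x ∈ Icc (0 : ℝ) 1, m ≤ ‖dds 1 γ x‖) {s s' : ℝ} (hs : s ∈ Icc 0 (curveLength γ))
    (hs' : s' ∈ Icc 0 (curveLength γ)) : |arcInv γ s - arcInv γ s'| ≤ m⁻¹ * |s - s'| := by
  wlog hle : s' ≤ s generalizing s s'
  · rw [abs_sub_comm, abs_sub_comm s s']
    exact this hs' hs (le_of_not_ge hle)
  have hmono := h.arcInv_strictMonoOn.monotoneOn hs' hs hle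
  have := h.mul_sub_le_arclength_sub hm (h.arcInv_mem hs') (h.arcInv_mem hs) hmono
  rw [h.arclength_arcInv hs, h.arclength_arcInv hs'] at this
  rw [abs_of_nonneg (sub_nonneg.2 hmono), abs_of_nonneg (sub_nonneg.2 hle), le_inv_mul_iff₀ hm0]
  exact this

theorem continuousOn_arcInv (h : IsRegularCurve 1 γ) :
    ContinuousOn (arcInv γ) (Icc 0 (curveLength γ)) := by
  obtain ⟨m, hm0, hm⟩ := h.exists_speed_bound
  have : LipschitzOnWith ⟨m⁻¹, by positivity⟩ (arcInv γ) (Icc 0 (curveLength γ)) :=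
    LipschitzOnWith.of_dist_le_mul fun s hs s' hs' => h.arcInv_lipschitz hm0 hm hs hs'
  exact this.continuousOn

theorem hasDerivWithinAt_arcInv (h : IsRegularCurve 1 γ) {s : ℝ}
    (hs : s ∈ Icc 0 (curveLength γ)) :
    HasDerivWithinAt (arcInv γ) ‖dds 1 γ (arcInv γ s)‖⁻¹ (Icc 0 (curveLength γ)) s := by
  have hmem := h.arcInv_mem hs
  have hne : ‖dds 1 γ (arcInv γ s)‖ ≠ 0 := norm_ne_zero_iff.2 (h.2 _ hmem)
  have htend : Filter.Tendsto (arcInv γ) (nhdsWithin s (Icc 0 (curveLength γ)))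
      (nhdsWithin (arcInv γ s) (Icc 0 1)) :=
    tendsto_nhdsWithin_of_tendsto_nhds_of_eventually_within _ (h.continuousOn_arcInv s hs)
      (eventually_nhdsWithin_of_forall fun u hu => h.arcInv_mem hu)
  have hσ : HasFDerivWithinAt (arclength γ)
      (ContinuousLinearEquiv.unitsEquivAut ℝ (Units.mk0 _ hne) : ℝ →L[ℝ] ℝ) (Icc 0 1)
      (arcInv γ s) := by
    refine (h.hasDerivWithinAt_arclength hmem).hasFDerivWithinAt.congr_fderiv ?_
    ext; simp
  have := (hσ.of_local_left_inverse htend hs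
    (eventually_nhdsWithin_of_forall fun u hu => h.arclength_arcInv hu)).hasDerivWithinAt
  convert! this using 1
  simp

end IsRegularCurve
end ElasticNetwork

theorem norm_normalize_sub_normalize_le {E : Type*} [NormedAddCommGroup E] [NormedSpace ℝ E]
    {m : ℝ} (hm : 0 < m) {v w : E} (hv : m ≤ ‖v‖) (hw : m ≤ ‖w‖) :
    ‖‖v‖⁻¹ • v - ‖w‖⁻¹ • w‖ ≤ 2 * m⁻¹ * ‖v - w‖ := by
  have hv0 : 0 < ‖v‖ := hm.trans_le hv
  have hw0 : 0 < ‖w‖ := hm.trans_le hw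
  have h1 : ‖v‖⁻¹ • v - ‖w‖⁻¹ • w = ‖v‖⁻¹ • (v - w) + (‖v‖⁻¹ - ‖w‖⁻¹) • w := by module
  have h2 : ‖(‖v‖⁻¹ - ‖w‖⁻¹) • w‖ = ‖v‖⁻¹ * |‖w‖ - ‖v‖| := by
    rw [norm_smul, Real.norm_eq_abs,
      show ‖v‖⁻¹ - ‖w‖⁻¹ = ‖v‖⁻¹ * ‖w‖⁻¹ * (‖w‖ - ‖v‖) by field_simp, abs_mul,
      abs_of_pos (by positivity)]
    field_simp
  have h3 : |‖w‖ - ‖v‖| ≤ ‖v - w‖ := by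
    rw [norm_sub_rev]; exact abs_norm_sub_norm_le w v
  have h4 : ‖v‖⁻¹ ≤ m⁻¹ := inv_anti₀ hm hv
  rw [h1]
  calc _ ≤ ‖‖v‖⁻¹ • (v - w)‖ + ‖(‖v‖⁻¹ - ‖w‖⁻¹) • w‖ := norm_add_le _ _
    _ = ‖v‖⁻¹ * ‖v - w‖ + ‖v‖⁻¹ * |‖w‖ - ‖v‖| := by rw [h2, norm_smul, norm_inv, norm_norm]
    _ ≤ m⁻¹ * ‖v - w‖ + m⁻¹ * ‖v - w‖ := by gcongr
    _ = 2 * m⁻¹ * ‖v - w‖ := by ring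

namespace ElasticNetwork
namespace IsRegularCurve

variable {γ : ℝ → Plane}

theorem image_arcInv (h : IsRegularCurve 1 γ) {s s' : ℝ} (hs : s ∈ Icc 0 (curveLength γ))
    (hs' : s' ∈ Icc 0 (curveLength γ)) (hss' : s ≤ s') :
    arcInv γ '' Icc s s' = Icc (arcInv γ s) (arcInv γ s') := by
  have hsub : Icc s s' ⊆ Icc 0 (curveLength γ) := Icc_subset_Icc hs.1 hs'.2
  exact (h.continuousOn_arcInv.mono hsub).image_Icc_of_monotoneOn hss'
    (h.arcInv_strictMonoOn.monotoneOn.mono hsub)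

theorem image_arcInv_subset (h : IsRegularCurve 1 γ) :
    arcInv γ '' Icc 0 (curveLength γ) ⊆ Icc 0 1 := by
  rintro _ ⟨s, hs, rfl⟩
  exact h.arcInv_mem hs

theorem integral_comp_arcInv (h : IsRegularCurve 1 γ) (f : ℝ → ℝ) {s s' : ℝ}
    (hs : s ∈ Icc 0 (curveLength γ)) (hs' : s' ∈ Icc 0 (curveLength γ)) (hss' : s ≤ s') :
    ∫ x in arcInv γ s..arcInv γ s', f x
      = ∫ u in s..s', ‖dds 1 γ (arcInv γ u)‖⁻¹ * f (arcInv γ u) := by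
  have hsub : Icc s s' ⊆ Icc 0 (curveLength γ) := Icc_subset_Icc hs.1 hs'.2
  rw [intervalIntegral.integral_of_le (h.arcInv_strictMonoOn.monotoneOn hs hs' hss'),
    intervalIntegral.integral_of_le hss', ← integral_Icc_eq_integral_Ioc,
    ← integral_Icc_eq_integral_Ioc, ← h.image_arcInv hs hs' hss',
    integral_image_eq_integral_abs_deriv_smul measurableSet_Icc
      (fun u hu => (h.hasDerivWithinAt_arcInv (hsub hu)).mono hsub)
      (h.arcInv_strictMonoOn.injOn.mono hsub)]
  simp only [abs_inv, abs_norm, smul_eq_mul]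

theorem integrableOn_comp_arcInv (h : IsRegularCurve 1 γ) {f : ℝ → ℝ}
    (hf : IntegrableOn f (Icc 0 1)) :
    IntegrableOn (fun u => ‖dds 1 γ (arcInv γ u)‖⁻¹ * f (arcInv γ u))
      (Icc 0 (curveLength γ)) := by
  have := (integrableOn_image_iff_integrableOn_abs_deriv_smul measurableSet_Icc
    (fun u hu => h.hasDerivWithinAt_arcInv hu) h.arcInv_strictMonoOn.injOn f).1
    (hf.mono_set h.image_arcInv_subset)
  simpa only [abs_inv, abs_norm, smul_eq_mul] using this

/-- The square carries two factors `|γ'|⁻¹`: one is the Jacobian of the change of variables, the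
other is at most `m⁻¹`. -/
theorem memLp_comp_arcInv (h : IsRegularCurve 1 γ) {f : ℝ → ℝ}
    (hf : MemLp f 2 (volume.restrict (Icc 0 1))) :
    MemLp (fun u => ‖dds 1 γ (arcInv γ u)‖⁻¹ * f (arcInv γ u)) 2
      (volume.restrict (Icc 0 (curveLength γ))) := by
  obtain ⟨m, hm0, hm⟩ := h.exists_speed_bound
  have h1 := (h.integrableOn_comp_arcInv (hf.integrable one_le_two)).aestronglyMeasurable
  rw [memLp_two_iff_integrable_sq h1]
  refine ((h.integrableOn_comp_arcInv hf.integrable_sq).const_mul m⁻¹).mono' (h1.pow 2) ?_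
  rw [ae_restrict_iff' measurableSet_Icc]
  refine Filter.Eventually.of_forall fun u hu => ?_
  have h2 : ‖dds 1 γ (arcInv γ u)‖⁻¹ ≤ m⁻¹ := inv_anti₀ hm0 (hm _ (h.arcInv_mem hu))
  rw [Real.norm_eq_abs, abs_of_nonneg (sq_nonneg _), mul_pow, sq (‖dds 1 γ (arcInv γ u)‖⁻¹),
    mul_assoc]
  gcongr

/-- The arclength parametrization of an `H²` immersion is a unit speed curve of class `H²`. -/
theorem exists_unitSpeedH2 (h : IsRegularCurve 1 γ) :
    ∃ τ a : ℝ → Plane, UnitSpeedH2 (curveLength γ) (arcParam γ) τ a := by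
  obtain ⟨g, hg, hgx⟩ := h.1.2
  obtain ⟨m, hm0, hm⟩ := h.exists_speed_bound
  set τ : ℝ → Plane := fun s => ‖dds 1 γ (arcInv γ s)‖⁻¹ • dds 1 γ (arcInv γ s) with hτ
  have hgi : IntegrableOn g (Icc 0 1) := hg.integrable one_le_two
  have hgii : ∀ x ∈ Icc (0 : ℝ) 1, IntervalIntegrable g volume 0 x := fun x hx =>
    (intervalIntegrable_of_integrableOn_Icc zero_le_one hgi).mono_set (by
      rw [uIcc_of_le hx.1, uIcc_of_le zero_le_one]; exact Icc_subset_Icc_right hx.2)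
  -- Normalization is Lipschitz away from the origin, so increments of `τ` are controlled by those
  -- of `γ'`. This yields the `L²` derivative of `τ` without a chain rule for composition with
  -- `arcInv`.
  have hinc : ∀ s ∈ Icc 0 (curveLength γ), ∀ s' ∈ Icc 0 (curveLength γ), s ≤ s' →
      dist (τ s) (τ s') ≤
        ∫ u in s..s', 2 * m⁻¹ * (‖dds 1 γ (arcInv γ u)‖⁻¹ * ‖g (arcInv γ u)‖) := by
    intro s hs s' hs' hss'
    have hx := h.arcInv_mem hs
    have hx' := h.arcInv_mem hs'
    have hxx' := h.arcInv_strictMonoOn.monotoneOn hs hs' hss'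
    rw [intervalIntegral.integral_const_mul,
      ← h.integral_comp_arcInv (fun x => ‖g x‖) hs hs' hss', dist_comm, dist_eq_norm]
    refine (norm_normalize_sub_normalize_le hm0 (hm _ hx') (hm _ hx)).trans ?_
    gcongr
    rw [hgx _ hx, hgx _ hx', add_sub_add_left_eq_sub,
      intervalIntegral.integral_interval_sub_left (hgii _ hx') (hgii _ hx)]
    exact intervalIntegral.norm_integral_le_integral_norm hxx'
  obtain ⟨a, ha, haτ⟩ := exists_memLp_primitive_of_dist_le h.curveLength_pos (f := τ)
    ((h.memLp_comp_arcInv hg.norm).const_mul (2 * m⁻¹)) (fun x hx y hy => by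
      rcases le_total x y with hxy | hxy
      · exact (hinc x hx y hy hxy).trans (le_abs_self _)
      · rw [dist_comm, intervalIntegral.integral_symm, abs_neg]
        exact (hinc y hy x hx hxy).trans (le_abs_self _))
  refine ⟨τ, a, h.curveLength_pos, fun s hs => ?_, fun s hs => ?_, ha, haτ⟩
  · exact (h.hasDerivWithinAt (h.arcInv_mem hs)).scomp s (h.hasDerivWithinAt_arcInv hs)
      (fun u hu => h.arcInv_mem hu)
  · have : ‖dds 1 γ (arcInv γ s)‖ ≠ 0 := norm_ne_zero_iff.2 (h.2 _ (h.arcInv_mem hs))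
    rw [hτ, norm_smul, norm_inv, norm_norm, inv_mul_cancel₀ this]

end IsRegularCurve
end ElasticNetwork

/-! ### Boundary terms and Hermite interpolation -/

namespace ElasticNetwork

theorem firstVariation_congr_ae {L : ℝ} (hL : 0 ≤ L) {τ a a' ψ : ℝ → Plane}
    (h : ∀ᵐ s, s ∈ Icc 0 L → a s = a' s) : firstVariation L τ a ψ = firstVariation L τ a' ψ := by
  refine intervalIntegral.integral_congr_ae ?_
  filter_upwards [h] with s hs hsL
  rw [uIoc_of_le hL] at hsL
  rw [hs (Ioc_subset_Icc_self hsL)]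

theorem firstVariation_zero {L : ℝ} (hL : 0 < L) (τ a : ℝ → Plane) :
    firstVariation L τ a (fun _ => 0) = 0 := by
  have h0 : ∀ s ∈ Icc 0 L, dds L (fun _ => (0 : Plane)) s = 0 := fun s hs =>
    dds_of_hasDerivAt hL (hasDerivAt_const s 0) hs
  rw [firstVariation, intervalIntegral.integral_congr (g := fun _ => (0 : ℝ)) fun s hs => ?_,
    intervalIntegral.integral_zero]
  rw [uIcc_of_le hL.le] at hs
  simp only [dds_congr h0 hs, h0 s hs, inner_zero_right, mul_zero, add_zero]

/-- Integration by parts: on a solution, the first variation is a boundary term. -/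
theorem IsElastica.firstVariation_eq {L : ℝ} {c τ a ψ : ℝ → Plane} {F : Plane}
    (h : IsElastica L c τ a F) (hψ : ContDiffOn ℝ ∞ ψ (Icc 0 L)) :
    firstVariation L τ a ψ = (2 * inner ℝ (a L) (dds L ψ L) - inner ℝ F (ψ L))
      - (2 * inner ℝ (a 0) (dds L ψ 0) - inner ℝ F (ψ 0)) := by
  have hu := h.uniqueDiffOn
  have hψ1 : ContDiffOn ℝ ∞ (dds L ψ) (Icc 0 L) :=
    ((contDiffOn_infty_iff_derivWithin hu).1 hψ).2
  have hψ2 : ContDiffOn ℝ ∞ (dds L (dds L ψ)) (Icc 0 L) :=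
    ((contDiffOn_infty_iff_derivWithin hu).1 hψ1).2
  have hd1 : ∀ s ∈ Icc 0 L, HasDerivWithinAt ψ (dds L ψ s) (Icc 0 L) s := fun s hs =>
    (hψ.differentiableOn (by simp) s hs).hasDerivWithinAt
  have hd2 : ∀ s ∈ Icc 0 L, HasDerivWithinAt (dds L ψ) (dds L (dds L ψ) s) (Icc 0 L) s :=
    fun s hs => (hψ1.differentiableOn (by simp) s hs).hasDerivWithinAt
  have key : ∀ s ∈ Icc 0 L, HasDerivWithinAt
      (fun s => 2 * (inner ℝ (a s) (dds L ψ s) : ℝ) - inner ℝ F (ψ s))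
      (2 * inner ℝ (a s) (dds L (dds L ψ) s)
        + (1 - 3 * ‖a s‖ ^ 2) * inner ℝ (τ s) (dds L ψ s)) (Icc 0 L) s := fun s hs => by
    have h1 := ((h.curvature_deriv s hs).inner ℝ (hd2 s hs)).const_mul 2
    have h2 := (hasDerivWithinAt_const s (Icc 0 L) F).inner ℝ (hd1 s hs)
    refine (h1.sub h2).congr_deriv ?_
    simp only [inner_add_left, real_inner_smul_left, inner_zero_left,
      real_inner_self_eq_norm_sq]
    ring
  have hac := h.contDiffOn_curvature.continuousOn
  have hτc := h.contDiffOn_tangent.continuousOn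
  rw [firstVariation]
  refine intervalIntegral.integral_eq_sub_of_hasDerivAt_of_le h.pos.le
    (fun s hs => (key s hs).continuousWithinAt)
    (fun s hs => (key s (Ioo_subset_Icc_self hs)).hasDerivAt (Icc_mem_nhds hs.1 hs.2)) ?_
  refine intervalIntegrable_of_integrableOn_Icc h.pos.le (ContinuousOn.integrableOn_Icc ?_)
  exact (continuousOn_const.mul (hac.inner hψ2.continuousOn)).add
    ((continuousOn_const.sub (continuousOn_const.mul (hac.norm.pow 2))).mul
      (hτc.inner hψ1.continuousOn))

/-- Cubic Hermite interpolation. -/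
theorem exists_hermite {E : Type*} [NormedAddCommGroup E] [NormedSpace ℝ E] {L : ℝ}
    (hL : L ≠ 0) (p₀ p₁ d₀ d₁ : E) :
    ∃ ψ : ℝ → E, ContDiff ℝ ∞ ψ ∧ ψ 0 = p₀ ∧ ψ L = p₁ ∧ HasDerivAt ψ d₀ 0 ∧ HasDerivAt ψ d₁ L := by
  set p := p₁ - p₀ - L • d₀ with hp
  set d := d₁ - d₀ with hd
  set A := (3 / L ^ 2) • p - (1 / L) • d with hA
  set B := (1 / L ^ 2) • d - (2 / L ^ 3) • p with hB
  have hderiv : ∀ s : ℝ, HasDerivAt (fun s : ℝ => p₀ + s • d₀ + s ^ 2 • A + s ^ 3 • B)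
      (d₀ + (2 * s) • A + (3 * s ^ 2) • B) s := fun s => by
    have h1 := (((hasDerivAt_id s).smul_const d₀).const_add p₀).add
      ((hasDerivAt_pow 2 s).smul_const A)
    refine (h1.add ((hasDerivAt_pow 3 s).smul_const B)).congr_deriv ?_
    simp
  refine ⟨fun s => p₀ + s • d₀ + s ^ 2 • A + s ^ 3 • B, by fun_prop, by simp, ?_, ?_, ?_⟩
  · have h1 : L ^ 2 • A + L ^ 3 • B = p := by
      have e1 : L ^ 2 * (3 / L ^ 2) - L ^ 3 * (2 / L ^ 3) = 1 := by field_simp; norm_num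
      have e2 : L ^ 3 * (1 / L ^ 2) - L ^ 2 * (1 / L) = 0 := by field_simp; norm_num
      calc _ = (L ^ 2 * (3 / L ^ 2) - L ^ 3 * (2 / L ^ 3)) • p
          + (L ^ 3 * (1 / L ^ 2) - L ^ 2 * (1 / L)) • d := by rw [hA, hB]; module
        _ = p := by rw [e1, e2]; module
    show p₀ + L • d₀ + L ^ 2 • A + L ^ 3 • B = p₁
    rw [add_assoc, h1, hp]
    module
  · simpa using hderiv 0
  · refine (hderiv L).congr_deriv ?_
    have h1 : (2 * L) • A + (3 * L ^ 2) • B = d := by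
      have e1 : 2 * L * (3 / L ^ 2) - 3 * L ^ 2 * (2 / L ^ 3) = 0 := by field_simp; norm_num
      have e2 : 3 * L ^ 2 * (1 / L ^ 2) - 2 * L * (1 / L) = 1 := by field_simp; norm_num
      calc _ = (2 * L * (3 / L ^ 2) - 3 * L ^ 2 * (2 / L ^ 3)) • p
          + (3 * L ^ 2 * (1 / L ^ 2) - 2 * L * (1 / L)) • d := by rw [hA, hB]; module
        _ = d := by rw [e1, e2]; module
    rw [add_assoc, h1, hd]
    module

/-! ### Variations of the network -/

namespace Network

variable {N : ℕ} {𝒩 : Network N}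

theorem IsCriticalPoint.isRegularCurve (h : 𝒩.IsCriticalPoint) (i : Fin N) :
    IsRegularCurve 1 (edgeCurve 𝒩.map i) :=
  (𝒩.curves i).resolve_left (h.1 i)

/-- The first variation of a critical point vanishes. -/
theorem IsCriticalPoint.sum_firstVariation_eq_zero (h : 𝒩.IsCriticalPoint)
    {τ a : Fin N → ℝ → Plane} (hu : ∀ i, UnitSpeedH2 (𝒩.len i) (𝒩.arc i) (τ i) (a i))
    {ψ : Fin N → ℝ → Plane} (hψ : 𝒩.IsRegularVariation ψ) :
    ∑ i, firstVariation (𝒩.len i) (τ i) (a i) (ψ i) = 0 := by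
  have h1 : HasDerivAt (𝒩.variationEnergy ψ)
      (∑ i, firstVariation (𝒩.len i) (τ i) (a i) (ψ i)) 0 :=
    HasDerivAt.fun_sum fun i _ => (hu i).hasDerivAt_elasticEnergy (hψ.smooth i)
  exact h1.unique (h.2 ψ hψ)

@[simp] theorem arcEnd_zero (i : Fin N) : 𝒩.arcEnd (0, i) = 0 := by simp [arcEnd]

@[simp] theorem arcEnd_one (i : Fin N) : 𝒩.arcEnd (1, i) = 𝒩.len i := by simp [arcEnd]

/-- Each curve of a critical point is an elastica. -/
theorem IsCriticalPoint.exists_isElastica (h : 𝒩.IsCriticalPoint)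
    {τ a : Fin N → ℝ → Plane} (hu : ∀ i, UnitSpeedH2 (𝒩.len i) (𝒩.arc i) (τ i) (a i))
    (i : Fin N) :
    ∃ (a' : ℝ → Plane) (F : Plane), IsElastica (𝒩.len i) (𝒩.arc i) (τ i) a' F ∧
      ∀ᵐ s, s ∈ Icc 0 (𝒩.len i) → a i s = a' s := by
  refine (hu i).exists_isElastica fun ψ hψ h0 hL hd0 hdL => ?_
  -- Extension by zero to the other edges: all values and first derivatives vanish at every
  -- endpoint, so the junction conditions hold for any graph.
  set Ψ : Fin N → ℝ → Plane := Function.update (fun _ _ => 0) i ψ with hΨ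
  have hself : Ψ i = ψ := Function.update_self ..
  have hne : ∀ j, j ≠ i → Ψ j = fun _ => 0 := fun j hj => Function.update_of_ne hj ..
  have hdψ : ∀ s, HasDerivAt ψ (deriv ψ s) s := fun s =>
    (hψ.differentiable (by simp) s).hasDerivAt
  have hpos := fun j => (hu j).pos
  have hend : ∀ v : Endpoint N, Ψ v.2 (𝒩.arcEnd v) = 0 ∧
      dds (𝒩.len v.2) (Ψ v.2) (𝒩.arcEnd v) = 0 := by
    rintro ⟨z, j⟩
    have hmem : 𝒩.arcEnd (z, j) ∈ Icc 0 (𝒩.len j) := by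
      fin_cases z
      · simpa using (hpos j).le
      · simpa using (hpos j).le
    rcases eq_or_ne j i with rfl | hj
    · simp only [hself]
      fin_cases z
      · simp only [Fin.zero_eta, arcEnd_zero] at hmem ⊢
        exact ⟨h0, (dds_of_hasDerivAt (hpos j) (hdψ 0) hmem).trans hd0⟩
      · simp only [Fin.mk_one, arcEnd_one] at hmem ⊢
        exact ⟨hL, (dds_of_hasDerivAt (hpos j) (hdψ _) hmem).trans hdL⟩
    · simp only [hne j hj]
      exact ⟨trivial, dds_of_hasDerivAt (hpos j) (hasDerivAt_const _ 0) hmem⟩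
  have hvar : 𝒩.IsRegularVariation Ψ := by
    refine ⟨fun j => ?_, fun v w _ => ?_, fun v w _ => ?_⟩
    · rcases eq_or_ne j i with rfl | hj
      · rw [hself]; exact hψ.contDiffOn
      · rw [hne j hj]; exact contDiffOn_const
    · rw [(hend v).1, (hend w).1]
    · rw [(hend v).2, (hend w).2, inner_zero_left, inner_zero_left]
  have hsum := h.sum_firstVariation_eq_zero hu hvar
  rw [Finset.sum_eq_single i (fun j _ hj => by rw [hne j hj, firstVariation_zero (hpos j)])
    (by simp), hself] at hsum
  exact hsum

/-- If the first variation of a network of elasticae vanishes along every regular variation, the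
boundary terms for prescribed values `A` and derivatives `D` at the endpoints balance. -/
theorem sum_boundary_eq
    {τ a : Fin N → ℝ → Plane} {F : Fin N → Plane}
    (he : ∀ i, IsElastica (𝒩.len i) (𝒩.arc i) (τ i) (a i) (F i))
    (hz : ∀ ψ, 𝒩.IsRegularVariation ψ →
      ∑ i, firstVariation (𝒩.len i) (τ i) (a i) (ψ i) = 0)
    {A D : Endpoint N → Plane}
    (hA : ∀ v w, 𝒩.graph.vertex v = 𝒩.graph.vertex w → A v = A w)
    (hD : ∀ v w, 𝒩.graph.vertex v = 𝒩.graph.vertex w →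
      (inner ℝ (D v) (normal (𝒩.len v.2) (𝒩.arc v.2) (𝒩.arcEnd v)) : ℝ)
        = inner ℝ (D w) (normal (𝒩.len w.2) (𝒩.arc w.2) (𝒩.arcEnd w))) :
    ∑ i, (2 * (inner ℝ (a i (𝒩.len i)) (D (1, i)) : ℝ) - inner ℝ (F i) (A (1, i)))
      = ∑ i, (2 * (inner ℝ (a i 0) (D (0, i)) : ℝ) - inner ℝ (F i) (A (0, i))) := by
  choose ψ hψ h0 hL hd0 hdL using fun i =>
    exists_hermite (he i).pos.ne' (A (0, i)) (A (1, i)) (D (0, i)) (D (1, i))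
  have m0 : ∀ i, (0 : ℝ) ∈ Icc 0 (𝒩.len i) := fun i => ⟨le_rfl, (he i).pos.le⟩
  have mL : ∀ i, 𝒩.len i ∈ Icc 0 (𝒩.len i) := fun i => ⟨(he i).pos.le, le_rfl⟩
  have hend : ∀ v : Endpoint N, ψ v.2 (𝒩.arcEnd v) = A v ∧
      dds (𝒩.len v.2) (ψ v.2) (𝒩.arcEnd v) = D v := by
    rintro ⟨z, j⟩
    fin_cases z
    · simp only [Fin.zero_eta, arcEnd_zero]
      exact ⟨h0 j, dds_of_hasDerivAt (he j).pos (hd0 j) (m0 j)⟩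
    · simp only [Fin.mk_one, arcEnd_one]
      exact ⟨hL j, dds_of_hasDerivAt (he j).pos (hdL j) (mL j)⟩
  have hvar : 𝒩.IsRegularVariation ψ := by
    refine ⟨fun i => (hψ i).contDiffOn, fun v w hvw => ?_, fun v w hvw => ?_⟩
    · rw [(hend v).1, (hend w).1, hA v w hvw]
    · rw [(hend v).2, (hend w).2, hD v w hvw]
  have key := hz ψ hvar
  have hterm : ∀ i, firstVariation (𝒩.len i) (τ i) (a i) (ψ i)
      = (2 * (inner ℝ (a i (𝒩.len i)) (D (1, i)) : ℝ) - inner ℝ (F i) (A (1, i)))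
        - (2 * (inner ℝ (a i 0) (D (0, i)) : ℝ) - inner ℝ (F i) (A (0, i))) := fun i => by
    rw [(he i).firstVariation_eq (hψ i).contDiffOn, dds_of_hasDerivAt (he i).pos (hd0 i) (m0 i),
      dds_of_hasDerivAt (he i).pos (hdL i) (mL i), h0, hL]
  rw [Finset.sum_congr rfl fun i _ => hterm i, Finset.sum_sub_distrib] at key
  exact sub_eq_zero.1 key

end Network
end ElasticNetwork

/-! ### The proposition -/

open ElasticNetwork Network in
theorem mainTheorem8 {N : ℕ} (𝒩 : ElasticNetwork.Network N) (h𝒩 : 𝒩.IsCriticalPoint) :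
    (∀ i : Fin N,
      AnalyticOn ℝ (𝒩.arc i) (Set.Icc 0 (𝒩.len i)) ∧
      (∀ s ∈ Set.Ioo 0 (𝒩.len i),
        (2 : ℝ) • ElasticNetwork.perpDeriv (𝒩.len i) (𝒩.arc i)
            (ElasticNetwork.perpDeriv (𝒩.len i) (𝒩.arc i) (𝒩.kVec i)) s
          + ‖𝒩.kVec i s‖ ^ 2 • 𝒩.kVec i s - 𝒩.kVec i s = 0) ∧
      (∀ s ∈ Set.Ioo 0 (𝒩.len i),
        2 * iteratedDerivWithin 2 (𝒩.k i) (Set.Icc 0 (𝒩.len i)) s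
          + 𝒩.k i s ^ 3 - 𝒩.k i s = 0)) ∧
    (∀ p : 𝒩.graph.Vertex,
      ∑ i ∈ 𝒩.graph.edgesAt p 1, 𝒩.k i (𝒩.len i) = ∑ i ∈ 𝒩.graph.edgesAt p 0, 𝒩.k i 0 ∧
      ∑ i ∈ 𝒩.graph.edgesAt p 1, 𝒩.flux i (𝒩.len i)
        = ∑ i ∈ 𝒩.graph.edgesAt p 0, 𝒩.flux i 0) := by
  classical
  choose τ a₀ hu using fun i => (h𝒩.isRegularCurve i).exists_unitSpeedH2
  -- `a₀` is only an `L²` representative; the smooth `a` replaces it, so that curvature and flux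
  -- have meaning at the endpoints.
  choose a F he hae using fun i => h𝒩.exists_isElastica hu i
  have hz : ∀ ψ, 𝒩.IsRegularVariation ψ →
      ∑ i, firstVariation (𝒩.len i) (τ i) (a i) (ψ i) = 0 := fun ψ hψ => by
    rw [← h𝒩.sum_firstVariation_eq_zero hu hψ]
    exact Finset.sum_congr rfl fun i _ => (firstVariation_congr_ae (he i).pos.le (hae i)).symm
  have m0 : ∀ i, (0 : ℝ) ∈ Icc 0 (𝒩.len i) := fun i => ⟨le_rfl, (he i).pos.le⟩
  have mL : ∀ i, 𝒩.len i ∈ Icc 0 (𝒩.len i) := fun i => ⟨(he i).pos.le, le_rfl⟩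
  refine ⟨fun i => ⟨(he i).analyticOn, fun s hs => (he i).elastica_equation
    (Ioo_subset_Icc_self hs), fun s hs => (he i).iteratedDerivWithin_two_curvature
    (Ioo_subset_Icc_self hs)⟩, fun p => ⟨?_, ?_⟩⟩
  · have hunit : ∀ v : Endpoint N,
        (inner ℝ (normal (𝒩.len v.2) (𝒩.arc v.2) (𝒩.arcEnd v))
          (normal (𝒩.len v.2) (𝒩.arc v.2) (𝒩.arcEnd v)) : ℝ) = 1 := by
      rintro ⟨z, i⟩
      fin_cases z
      · simp only [Fin.zero_eta, arcEnd_zero]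
        rw [(he i).normal_eq (m0 i), inner_rot_rot, (he i).inner_tangent_self (m0 i)]
      · simp only [Fin.mk_one, arcEnd_one]
        rw [(he i).normal_eq (mL i), inner_rot_rot, (he i).inner_tangent_self (mL i)]
    -- With derivative `ν` at the endpoints in `p`, the normal components there all equal `1`, and
    -- the boundary terms reduce to `2⟨a, ν⟩ = 2k`. Initial and final endpoints are summed
    -- separately, so loops need no special treatment.
    have key := sum_boundary_eq he hz (A := fun _ => 0)
      (D := fun v => if 𝒩.graph.vertex v = p
        then normal (𝒩.len v.2) (𝒩.arc v.2) (𝒩.arcEnd v) else 0)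
      (fun _ _ _ => rfl) (fun v w hvw => by
        by_cases hv : 𝒩.graph.vertex v = p
        · simp only [hv, hvw ▸ hv, if_true, hunit]
        · simp only [hv, hvw ▸ hv, if_false, inner_zero_left])
    have hk1 : ∀ i, (inner ℝ (a i (𝒩.len i)) (normal (𝒩.len i) (𝒩.arc i) (𝒩.len i)) : ℝ)
        = 𝒩.k i (𝒩.len i) := fun i => by
      rw [(he i).normal_eq (mL i)]; exact ((he i).curvature_eq (mL i)).symm
    have hk0 : ∀ i, (inner ℝ (a i 0) (normal (𝒩.len i) (𝒩.arc i) 0) : ℝ) = 𝒩.k i 0 := fun i => by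
      rw [(he i).normal_eq (m0 i)]; exact ((he i).curvature_eq (m0 i)).symm
    simp only [apply_ite (inner ℝ _), inner_zero_right, sub_zero, arcEnd_zero, arcEnd_one, hk0,
      hk1, ← Finset.mul_sum] at key
    rw [NGraph.edgesAt, NGraph.edgesAt, Finset.sum_filter, Finset.sum_filter]
    convert! mul_left_cancel₀ two_ne_zero key
  · have hf1 : ∀ i, 𝒩.flux i (𝒩.len i) = F i := fun i => (he i).flux_eq (mL i)
    have hf0 : ∀ i, 𝒩.flux i 0 = F i := fun i => (he i).flux_eq (m0 i)
    -- Moving the junction `p` by an arbitrary `X` with zero endpoint derivatives leaves only `⟨F,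
    -- X⟩`, and `F` is the flux at both ends.
    refine ext_inner_right ℝ fun X => ?_
    have key := sum_boundary_eq he hz
      (A := fun v => if 𝒩.graph.vertex v = p then X else 0) (D := fun _ => 0)
      (fun v w hvw => by rw [hvw]) (fun _ _ _ => by rw [inner_zero_left, inner_zero_left])
    simp only [apply_ite (inner ℝ _), inner_zero_right, mul_zero, zero_sub,
      Finset.sum_neg_distrib, neg_inj] at key
    simp only [hf1, hf0, sum_inner]
    rw [NGraph.edgesAt, NGraph.edgesAt, Finset.sum_filter, Finset.sum_filter]
    convert! key
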